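/- Let $n\ge 2$, $N\ge 1$, $1<p<\infty$, $\mu\in[0,1]$, and let $\Omega\subset\mathbb{R}^n$ be open and bounded. For complex matrices $Y,Z\in\mathbb{C}^{N\times n}$ let $\langle Y,Z\rangle=\sum_{k,j}Y_{kj}\overline{Z_{kj}}$ and $|Z|=\langle Z,Z\rangle^{1/2}$; for real matrices let $y:z=\sum_{k,j}y_{kj}z_{kj}$ and $|z|=(z:z)^{1/2}$. For a real or complex matrix $\eta$ let $$\mathbb{V}_p^\mu(\eta)=(\mu^2+|\eta|^2)^{\frac{p-2}{2}}\eta \qquad(\text{with } \mathbb{V}_p^\mu(0)=0).$$ Let $c_1,c_2>0$ be constants such that $$c_1(\mu^2+|y|^2+|z|^2)^{\frac{p-2}{2}}|y-z|^2\le\big(\mathbb{V}_p^\mu(y)-\mathbb{V}_p^\mu(z)\big):(y-z)\le c_2(\mu^2+|y|^2+|z|^2)^{\frac{p-2}{2}}|y-z|^2$$ for all $y,z\in\mathbb{R}^{2N\times n}$ (where all three terms are read as $0$ if $y=z$), and put $c_0=\sqrt{(c_2/c_1)^2-1}$. Let $\gamma_0,\gamma_1,\gamma_2>0$, and let $\mathfrak{a}:\Omega\to\mathbb{C}$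 be measurable with $$\gamma_1\le|\mathfrak{a}(x)|\le\gamma_2\quad\text{and}\quad \mathrm{Re}\,\mathfrak{a}(x)-c_0|\mathrm{Im}\,\mathfrak{a}(x)|>\gamma_0\qquad\text{for a.e. }x\in\Omega.$$ Let $\mathbf{F}\in L^p(\Omega;\mathbb{C}^{N\times n})$. Then the problem $$-\mathrm{div}\big(\mathfrak{a}(x)\mathbb{V}_p^\mu(\mathrm{D}\mathbf{u})\big)=-\mathrm{div}\big(|\mathbf{F}|^{p-2}\mathbf{F}\big)\ \text{ in }\Omega,\qquad \mathbf{u}=\mathbf{0}\ \text{ on }\partial\Omega,$$ has exactly one weak solution: there is one and only one $\mathbf{u}\in W_0^{1,p}(\Omega;\mathbb{C}^N)$ (functions that agree a.e. in $\Omega$ being identified) such that $$\int_\Omega\mathfrak{a}(x)\,\langle\mathbb{V}_p^\mu(\mathrm{D}\mathbf{u}),\mathrm{D}\varphi\rangle\,dx=\int_\Omega\langle|\mathbf{F}|^{p-2}\mathbf{F},\mathrm{D}\varphi\rangle\,dx\qquad\text{for every }\varphi\in W_0^{1,p}(\Omega;\mathbb{C}^N).$$ Here $W^{1,p}(\Omega;\mathbb{C}^N)$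 consists of the $\mathbf{g}\in L^p(\Omega;\mathbb{C}^N)$ whose weak gradient $\mathrm{D}\mathbf{g}=(\partial g_k/\partial x_j)_{k,j}$ belongs to $L^p(\Omega;\mathbb{C}^{N\times n})$, with the norm $\big(\int_\Omega(|\mathbf{g}|^p+|\mathrm{D}\mathbf{g}|^p)\,dx\big)^{1/p}$, and $W_0^{1,p}(\Omega;\mathbb{C}^N)$ is the closure of $C_c^\infty(\Omega;\mathbb{C}^N)$ in it. -/

import Mathlib

open MeasureTheory TopologicalSpace
open scoped ENNReal Distributions

noncomputable section

/-- The space `ℝⁿ` with the Euclidean norm. -/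
abbrev RVec (n : ℕ) : Type := EuclideanSpace ℝ (Fin n)

/-- The space `ℂᴺ` with the Euclidean norm. -/
abbrev CVec (N : ℕ) : Type := EuclideanSpace ℂ (Fin N)

/-- Complex `N × n` matrices `Z = (Z (k, j))`, with the norm `|Z| = (∑ |Z (k, j)|²)^(1/2)`. -/
abbrev CMat (N n : ℕ) : Type := EuclideanSpace ℂ (Fin N × Fin n)

/-- Real `m × n` matrices, with the canonical inner product `Y : Z = ∑ Y (k, j) Z (k, j)` and its
norm. -/
abbrev RMat (m n : ℕ) : Type := EuclideanSpace ℝ (Fin m × Fin n)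

/-- The inner product `⟨Y, Z⟩ = ∑ Y (k, j) * conj (Z (k, j))` on complex matrices, linear in the
first variable (Mathlib's `inner` is linear in the second one). -/
def matInner {N n : ℕ} (Y Z : CMat N n) : ℂ := inner ℂ Z Y

/-- The map `V_p^μ(η) = (μ² + |η|²)^((p-2)/2) η`, used both for real and for complex matrices. At
`μ = 0`, `η = 0` its value is `0` for every `p`. -/
def pField {E : Type*} [NormedAddCommGroup E] [NormedSpace ℝ E] (p μ : ℝ) (η : E) : E :=
  (μ ^ 2 + ‖η‖ ^ 2) ^ ((p - 2) / 2) • η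

/-- `c₁, c₂` are positive constants that bound the quotient of
`(V_p^μ(y) - V_p^μ(z)) : (y - z)` and `(μ² + |y|² + |z|²)^((p-2)/2) |y - z|²` from below and from
above, for all real `2N × n` matrices `y, z`. -/
structure IsStructurePair (N n : ℕ) (p μ c₁ c₂ : ℝ) : Prop where
  pos_left : 0 < c₁
  pos_right : 0 < c₂
  lower : ∀ y z : RMat (2 * N) n,
    c₁ * (μ ^ 2 + ‖y‖ ^ 2 + ‖z‖ ^ 2) ^ ((p - 2) / 2) * ‖y - z‖ ^ 2
      ≤ inner ℝ (pField p μ y - pField p μ z) (y - z)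
  upper : ∀ y z : RMat (2 * N) n,
    inner ℝ (pField p μ y - pField p μ z) (y - z)
      ≤ c₂ * (μ ^ 2 + ‖y‖ ^ 2 + ‖z‖ ^ 2) ^ ((p - 2) / 2) * ‖y - z‖ ^ 2

/-- The constant `c₀ = √((c₂ / c₁)² - 1)`. -/
def sectorConst (c₁ c₂ : ℝ) : ℝ := Real.sqrt ((c₂ / c₁) ^ 2 - 1)

/-- The assumptions on the coefficient: it is measurable on `Ω`, its modulus lies in `[γ₁, γ₂]`,
and its values satisfy the sectorial condition with the constants `c₀` and `γ₀`. -/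
structure IsAdmissibleCoeff {n : ℕ} (Ω : Opens (RVec n)) (c₀ γ₀ γ₁ γ₂ : ℝ) (a : RVec n → ℂ) :
    Prop where
  measurable : AEStronglyMeasurable a (volume.restrict (Ω : Set (RVec n)))
  bounds : ∀ᵐ x ∂(volume.restrict (Ω : Set (RVec n))), γ₁ ≤ ‖a x‖ ∧ ‖a x‖ ≤ γ₂
  sector : ∀ᵐ x ∂(volume.restrict (Ω : Set (RVec n))), γ₀ < (a x).re - c₀ * |(a x).im|

/-- The classical Jacobian matrix `(∂φ_k/∂x_j)` of a differentiable map `φ : ℝⁿ → ℂᴺ`. -/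
def jacobian {N n : ℕ} (φ : RVec n → CVec N) (x : RVec n) : CMat N n :=
  WithLp.toLp 2 fun i : Fin N × Fin n => (fderiv ℝ φ x (EuclideanSpace.single i.2 1)) i.1

/-- `u ∈ W^{1,p}(Ω; ℂᴺ)`, with the weak gradient `Du = G`. -/
structure HasSobolevGradient {N n : ℕ} (Ω : Opens (RVec n)) (p : ℝ)
    (u : RVec n → CVec N) (G : RVec n → CMat N n) : Prop where
  memLp : MemLp u (ENNReal.ofReal p) (volume.restrict (Ω : Set (RVec n)))
  memLp_grad : MemLp G (ENNReal.ofReal p) (volume.restrict (Ω : Set (RVec n)))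
  weak_deriv : ∀ (φ : 𝓓(Ω, ℝ)) (k : Fin N) (j : Fin n),
    ∫ x in (Ω : Set (RVec n)), (fderiv ℝ φ x (EuclideanSpace.single j 1)) • (u x k)
      = - ∫ x in (Ω : Set (RVec n)), (φ x) • (G x (k, j))

/-- The norm `(∫_Ω |u|^p + |G|^p)^(1/p)` of `W^{1,p}(Ω; ℂᴺ)`, where `G` stands for `Du`. -/
def sobolevNorm {N n : ℕ} (Ω : Opens (RVec n)) (p : ℝ)
    (u : RVec n → CVec N) (G : RVec n → CMat N n) : ℝ≥0∞ :=
  (∫⁻ x in (Ω : Set (RVec n)), (‖u x‖ₑ ^ p + ‖G x‖ₑ ^ p)) ^ (1 / p)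

/-- `u ∈ W₀^{1,p}(Ω; ℂᴺ)`, with the weak gradient `Du = G`: the function `u` lies in the closure of
`C_c^∞(Ω; ℂᴺ)` in `W^{1,p}(Ω; ℂᴺ)`. -/
def HasSobolevZeroGradient {N n : ℕ} (Ω : Opens (RVec n)) (p : ℝ)
    (u : RVec n → CVec N) (G : RVec n → CMat N n) : Prop :=
  HasSobolevGradient Ω p u G ∧
    ∀ ε : ℝ≥0∞, 0 < ε → ∃ φ : 𝓓(Ω, CVec N),
      sobolevNorm Ω p (fun x => u x - φ x) (fun x => G x - jacobian φ x) < ε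

/-- `u ∈ W₀^{1,p}(Ω; ℂᴺ)` is a weak solution of
`-div (a V_p^μ(Du)) = -div (|F|^(p-2) F)` in `Ω`, `u = 0` on `∂Ω`. -/
def IsWeakSolution {N n : ℕ} (Ω : Opens (RVec n)) (p μ : ℝ) (a : RVec n → ℂ)
    (F : RVec n → CMat N n) (u : RVec n → CVec N) : Prop :=
  ∃ Du : RVec n → CMat N n, HasSobolevZeroGradient Ω p u Du ∧
    ∀ (φ : RVec n → CVec N) (Dφ : RVec n → CMat N n), HasSobolevZeroGradient Ω p φ Dφ →
      ∫ x in (Ω : Set (RVec n)), a x * matInner (pField p μ (Du x)) (Dφ x)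
        = ∫ x in (Ω : Set (RVec n)), matInner ((‖F x‖ ^ (p - 2)) • F x) (Dφ x)

end

/-!
Identify a function of `W₀^{1,p}(Ω; ℂᴺ)` with its gradient. The Poincaré inequality
(`integral_norm_rpow_testFunction_le`, from integrating `∂_j x_j = 1` against `|φ|^p` by parts)
shows that the gradients form a closed subspace `gradSpace` of `L^p(Ω; ℂᴺˣⁿ)`, and that a function
is determined by its gradient. On this space the equation reads `S G = ℓ`, where
`S G H = ∫ Re (a ⟨V(G), H⟩)` for `V = V_p^μ`; the imaginary parts come for free because the space is
stable under multiplication by `i`.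

The operator `S` is monotone, although `a` is complex. Indeed
`Re (a ⟨V(Y) - V(Z), Y - Z⟩) ≥ (Re a - c₀ |Im a|) Re ⟨V(Y) - V(Z), Y - Z⟩` as soon as
`⟨V(Y) - V(Z), Y - Z⟩` lies in the sector `|Im| ≤ c₀ Re` (`abs_im_matInner_pField_sub_le`). With
`f(A) = (μ² + A)^((p-2)/2)`, `A = |Y|²` and `B = |Z|²`, this sector inequality reduces by
Cauchy-Schwarz to the scalar inequality
`(f(A) - f(B))² A B ≤ c₀² (A - B) (f(A)² A - f(B)² B)` (`sub_rpow_sq_mul_le`). The latter only needs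
that `κ = c₂ / c₁` is at least `max (p - 1) (1 / (p - 1))`, which is read off from the structure
inequalities on a single line through the origin, at infinity (`IsStructurePair.ratio_bounds`).

Existence is the theorem of Browder and Minty for `S - ℓ`
(`exists_eq_zero_of_monotone_of_coercive`). Its proof needs neither duality nor weak compactness:
the sets `{G | S H (H - G) ≥ ℓ (H - G)}` are closed and convex, any finitely many of them meet
inside the convex hull of the corresponding points `H`, by separation of convex sets
(`exists_stdSimplex_forall_nonneg_of_monotone`), and uniform convexity of `L^p`
(`Lp_exists_dist_lt`) turns the finite intersection property into a common point.

Uniqueness holds because `Re ⟨V(Y) - V(Z), Y - Z⟩ > 0` for `Y ≠ Z`, so that two solutions have the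
same gradient.
-/

/-! ### Monotone operators on uniformly convex spaces -/

open Filter Topology in
/-- Closed convex subsets of a set `B` on which a bounded function `Φ` is uniformly convex have the
finite intersection property: almost minimizers of `Φ` on the finite intersections form a Cauchy
filter. -/
theorem nonempty_inter_iInter_of_uniformlyConvex {E : Type*} [NormedAddCommGroup E]
    [NormedSpace ℝ E] [CompleteSpace E] {B : Set E} (hBc : IsClosed B) (hBconv : Convex ℝ B)
    {Φ : E → ℝ} {M : ℝ} (hΦ0 : ∀ x ∈ B, 0 ≤ Φ x) (hΦM : ∀ x ∈ B, Φ x ≤ M)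
    (hΦ : ∀ ε > 0, ∃ δ > 0, ∀ x ∈ B, ∀ y ∈ B,
      (Φ x + Φ y) / 2 - Φ ((1 / 2 : ℝ) • x + (1 / 2 : ℝ) • y) < δ → dist x y < ε)
    {ι : Type*} {S : ι → Set E} (hSc : ∀ i, IsClosed (S i)) (hSconv : ∀ i, Convex ℝ (S i))
    (hS : ∀ s : Finset ι, (B ∩ ⋂ i ∈ s, S i).Nonempty) : (B ∩ ⋂ i, S i).Nonempty := by
  classical
  set C : Finset ι → Set E := fun s => B ∩ ⋂ i ∈ s, S i with hC
  have hCanti : ∀ s t, s ⊆ t → C t ⊆ C s := fun s t hst =>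
    Set.inter_subset_inter_right _ (Set.biInter_subset_biInter_left hst)
  have hCconv : ∀ s, Convex ℝ (C s) := fun s =>
    hBconv.inter (convex_iInter₂ fun i _ => hSconv i)
  set m : Finset ι → ℝ := fun s => sInf (Φ '' C s) with hm
  have hbelow : ∀ s, BddBelow (Φ '' C s) := fun s =>
    ⟨0, by rintro _ ⟨x, hx, rfl⟩; exact hΦ0 x hx.1⟩
  have hmle : ∀ s x, x ∈ C s → m s ≤ Φ x := fun s x hx => csInf_le (hbelow s) ⟨x, hx, rfl⟩
  have hmM : BddAbove (Set.range m) := ⟨M, by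
    rintro _ ⟨s, rfl⟩
    obtain ⟨x, hx⟩ := hS s
    exact (hmle s x hx).trans (hΦM x hx.1)⟩
  -- `d` is the limit of the infima of `Φ` along the finite intersections; the sets `K` collect the
  -- almost minimizers, and midpoints of such points stay in the intersection by convexity.
  set d : ℝ := ⨆ s, m s with hd
  let K : Finset ι × {η : ℝ // 0 < η} → Set E := fun q => {x ∈ C q.1 | Φ x < d + q.2}
  have hKne : ∀ q, (K q).Nonempty := by
    rintro ⟨s, η, hη⟩
    have h1 : sInf (Φ '' C s) < d + η := by
      have : m s ≤ d := le_ciSup hmM s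
      change m s < d + η
      linarith
    obtain ⟨_, ⟨x, hx, rfl⟩, hlt⟩ := exists_lt_of_csInf_lt ((hS s).image Φ) h1
    exact ⟨x, hx, hlt⟩
  have hdir : Directed (· ≥ ·) K := by
    rintro ⟨s, η, hη⟩ ⟨t, ζ, hζ⟩
    refine ⟨⟨s ∪ t, min η ζ, lt_min hη hζ⟩, ?_, ?_⟩
    · rintro x ⟨hx, hx'⟩
      refine ⟨hCanti _ _ Finset.subset_union_left hx, hx'.trans_le ?_⟩
      simp
    · rintro x ⟨hx, hx'⟩
      refine ⟨hCanti _ _ Finset.subset_union_right hx, hx'.trans_le ?_⟩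
      simp
  have : Nonempty (Finset ι × {η : ℝ // 0 < η}) := ⟨⟨∅, 1, one_pos⟩⟩
  have hbasis : (⨅ q, 𝓟 (K q)).HasBasis (fun _ => True) K := hasBasis_iInf_principal hdir
  have hcauchy : Cauchy (⨅ q, 𝓟 (K q)) := by
    refine Metric.cauchy_iff.2 ⟨hbasis.neBot_iff.2 fun {q} _ => hKne q, fun ε hε => ?_⟩
    obtain ⟨δ, hδ, H⟩ := hΦ ε hε
    obtain ⟨s, hs⟩ : ∃ s, d - δ / 2 < m s := exists_lt_of_lt_ciSup (by linarith)
    refine ⟨K ⟨s, δ / 2, half_pos hδ⟩, hbasis.mem_of_mem trivial, ?_⟩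
    rintro x ⟨hx, hx'⟩ y ⟨hy, hy'⟩
    refine H x hx.1 y hy.1 ?_
    have := hmle s _ (hCconv s hx hy (by norm_num : (0 : ℝ) ≤ 1 / 2)
      (by norm_num : (0 : ℝ) ≤ 1 / 2) (by norm_num))
    dsimp only at hx' hy'
    linarith
  obtain ⟨x, hx⟩ := CompleteSpace.complete hcauchy
  have := hcauchy.1
  have hmem : ∀ s, C s ∈ (⨅ q, 𝓟 (K q)) := fun s =>
    mem_of_superset (hbasis.mem_of_mem (i := (s, ⟨1, one_pos⟩)) trivial)
      (fun y (hy : y ∈ C s ∧ _) => hy.1)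
  have hlim : ∀ A : Set E, IsClosed A → A ∈ (⨅ q, 𝓟 (K q)) → x ∈ A := fun A hA hAm =>
    hA.mem_of_tendsto (tendsto_id'.2 hx) hAm
  have hxB : x ∈ B := hlim B hBc (mem_of_superset (hmem ∅) Set.inter_subset_left)
  refine ⟨x, hxB, ?_⟩
  refine Set.mem_iInter.2 fun i => hlim _ (hSc i) (mem_of_superset (hmem {i}) ?_)
  rintro y ⟨-, hy⟩
  simpa using hy

/-- The lemma of Debrunner and Flor for finitely many points: if the pairs `(x i, y i)` are monotone,
then some convex combination `z` of the points `x i` satisfies `0 ≤ y i (x i - z)` for all `i`. If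
there were none, separation from the negative orthant would give weights `w`, for which the double
sum `∑ w i * w j * y i (x j - x i)` is positive, whereas monotonicity makes it nonpositive. -/
theorem exists_stdSimplex_forall_nonneg_of_monotone {E : Type*} [AddCommGroup E] [Module ℝ E]
    {ι : Type*} [Fintype ι] [Nonempty ι] (x : ι → E) (y : ι → E →ₗ[ℝ] ℝ)
    (hmono : ∀ i j, 0 ≤ (y i - y j) (x i - x j)) :
    ∃ w ∈ stdSimplex ℝ ι, ∀ i, 0 ≤ y i (x i - ∑ j, w j • x j) := by
  classical
  by_contra! hcon
  set g : (ι → ℝ) → ι → ℝ := fun w i => y i (∑ j, w j • x j) - y i (x i) with hg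
  have hgeq : ∀ w i, g w i = ∑ j, w j * y i (x j) - y i (x i) := by
    intro w i; simp [hg]
  have hgcont : Continuous g := by
    refine continuous_pi fun i => ?_
    simp only [hgeq]
    fun_prop
  have hgconv : Convex ℝ (g '' stdSimplex ℝ ι) := by
    rintro _ ⟨v, hv, rfl⟩ _ ⟨w, hw, rfl⟩ a b ha hb hab
    refine ⟨a • v + b • w, convex_stdSimplex ℝ ι hv hw ha hb hab, ?_⟩
    ext i
    simp only [hgeq, Pi.add_apply, Pi.smul_apply, smul_eq_mul, add_mul, Finset.sum_add_distrib,
      mul_assoc, ← Finset.mul_sum]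
    linear_combination (y i (x i)) * hab
  have hCconv : Convex ℝ {z : ι → ℝ | z ≤ 0} := convex_Iic 0
  have hdisj : Disjoint (g '' stdSimplex ℝ ι) {z : ι → ℝ | z ≤ 0} := by
    rw [Set.disjoint_left]
    rintro _ ⟨w, hw, rfl⟩ hle
    obtain ⟨i, hi⟩ := hcon w hw
    have := hle i
    simp only [hg, Pi.zero_apply, map_sub] at this hi
    linarith
  obtain ⟨f, u, v, hu, huv, hv⟩ := geometric_hahn_banach_compact_closed hgconv
    ((isCompact_stdSimplex ℝ ι).image hgcont) hCconv isClosed_Iic hdisj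
  have hv0 : v < 0 := by simpa using hv 0 (le_refl (0 : ι → ℝ))
  have hf : ∀ z : ι → ℝ, f z = ∑ i, z i * f (Pi.single i 1) := by
    intro z
    conv_lhs => rw [pi_eq_sum_univ' z]
    rw [map_sum]
    refine Finset.sum_congr rfl fun i _ => ?_
    rw [map_smul, smul_eq_mul]
  -- `f` is bounded below on the negative orthant, so its coefficients are nonpositive.
  have hl : ∀ i, 0 ≤ - f (Pi.single i 1) := by
    intro i
    by_contra! hneg
    have hpos : 0 < f (Pi.single i 1) := by linarith
    have hmem : (-(-v / f (Pi.single i 1))) • (Pi.single i 1 : ι → ℝ) ≤ 0 := by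
      intro j
      have h1 : 0 ≤ -v / f (Pi.single i 1) := div_nonneg (by linarith) hpos.le
      by_cases hij : j = i
      · subst hij; simpa using h1
      · simp [hij]
    have := hv _ hmem
    rw [map_smul, smul_eq_mul, neg_mul, div_mul_cancel₀ _ hpos.ne'] at this
    linarith
  set l : ι → ℝ := fun i => - f (Pi.single i 1) with hldef
  have hsum : 0 < ∑ i, l i := by
    refine lt_of_le_of_ne (Finset.sum_nonneg fun i _ => hl i) fun h0 => ?_
    have hzero := (Finset.sum_eq_zero_iff_of_nonneg fun i _ => hl i).1 h0.symm
    obtain ⟨w, hw⟩ : (stdSimplex ℝ ι).Nonempty := ⟨_, single_mem_stdSimplex ℝ (Classical.arbitrary ι)⟩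
    have h1 := hu _ ⟨w, hw, rfl⟩
    rw [hf] at h1
    have : ∑ i, g w i * f (Pi.single i 1) = 0 := Finset.sum_eq_zero fun i hi => by
      have := hzero i hi
      simp only [neg_eq_zero] at this
      rw [this, mul_zero]
    linarith
  set w : ι → ℝ := fun i => l i / ∑ i, l i with hwdef
  have hw : w ∈ stdSimplex ℝ ι :=
    ⟨fun i => div_nonneg (hl i) hsum.le, by rw [← Finset.sum_div, div_self hsum.ne']⟩
  have hlt := hu _ ⟨w, hw, rfl⟩
  have hlw : ∀ i, f (Pi.single i 1) = -((∑ i, l i) * w i) := fun i => by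
    simp only [hwdef]; field_simp; simp [hldef]
  have key : ∑ i, g w i * w i ≤ 0 := by
    have e1 : ∑ i, g w i * w i = ∑ i, ∑ j, w i * w j * (y i (x j) - y i (x i)) := by
      refine Finset.sum_congr rfl fun i _ => ?_
      simp only [hgeq, mul_sub, Finset.sum_sub_distrib, ← Finset.sum_mul, ← Finset.mul_sum]
      rw [hw.2, mul_one, sub_mul, Finset.sum_mul, mul_comm (y i (x i))]
      congr 1
      exact Finset.sum_congr rfl fun j _ => by ring
    have e2 : ∑ i, g w i * w i = ∑ i, ∑ j, w i * w j * (y j (x i) - y j (x j)) := by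
      rw [e1, Finset.sum_comm]
      exact Finset.sum_congr rfl fun i _ => Finset.sum_congr rfl fun j _ => by ring
    have e3 : ∑ i, g w i * w i + ∑ i, g w i * w i
        = ∑ i, ∑ j, -(w i * w j * (y i - y j) (x i - x j)) := by
      conv_lhs => rw [e2]; lhs; rw [← e2, e1]
      simp only [← Finset.sum_add_distrib]
      refine Finset.sum_congr rfl fun i _ => Finset.sum_congr rfl fun j _ => ?_
      simp only [LinearMap.sub_apply, map_sub]
      ring
    have : ∑ i, ∑ j, -(w i * w j * (y i - y j) (x i - x j)) ≤ 0 :=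
      Finset.sum_nonpos fun i _ => Finset.sum_nonpos fun j _ =>
        neg_nonpos.2 (mul_nonneg (mul_nonneg (hw.1 i) (hw.1 j)) (hmono i j))
    linarith
  have : f (g w) = -(∑ i, l i) * ∑ i, g w i * w i := by
    rw [hf, Finset.mul_sum]
    exact Finset.sum_congr rfl fun i _ => by rw [hlw i]; ring
  nlinarith

open Filter Topology in
/-- The theorem of Browder and Minty on a space whose balls carry a uniformly convex function `Φ`: a
monotone, hemicontinuous operator that is coercive on the sphere of radius `R` has a zero. -/
theorem exists_eq_zero_of_monotone_of_coercive {E : Type*} [NormedAddCommGroup E]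
    [NormedSpace ℝ E] [CompleteSpace E] {R : ℝ} (hR : 0 < R) {Φ : E → ℝ} {M : ℝ}
    (hΦ0 : ∀ x ∈ Metric.closedBall (0 : E) R, 0 ≤ Φ x)
    (hΦM : ∀ x ∈ Metric.closedBall (0 : E) R, Φ x ≤ M)
    (hΦ : ∀ ε > 0, ∃ δ > 0, ∀ x ∈ Metric.closedBall (0 : E) R, ∀ y ∈ Metric.closedBall (0 : E) R,
      (Φ x + Φ y) / 2 - Φ ((1 / 2 : ℝ) • x + (1 / 2 : ℝ) • y) < δ → dist x y < ε)
    (T : E → E →L[ℝ] ℝ) (hmono : ∀ x y, 0 ≤ (T x - T y) (x - y))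
    (hemi : ∀ x h, Tendsto (fun t : ℝ => T (x + t • h) h) (𝓝[>] 0) (𝓝 (T x h)))
    (hcoer : ∀ x, ‖x‖ = R → 0 < T x x) : ∃ x, T x = 0 := by
  classical
  set B := Metric.closedBall (0 : E) R
  have hBconv : Convex ℝ B := convex_closedBall 0 R
  have h0B : (0 : E) ∈ B := Metric.mem_closedBall_self hR.le
  obtain ⟨x, hxB, hx⟩ := nonempty_inter_iInter_of_uniformlyConvex (ι := B)
    (S := fun y => {x : E | 0 ≤ T y (y - x)}) Metric.isClosed_closedBall hBconv hΦ0 hΦM hΦ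
    (fun y => isClosed_le continuous_const (by fun_prop))
    (fun y => by
      intro u hu v hv a b ha hb hab
      have hs : (y : E) - (a • u + b • v) = a • ((y : E) - u) + b • ((y : E) - v) := by
        conv_lhs => rw [← one_smul ℝ (y : E), ← hab]
        module
      simp only [Set.mem_ofPred_eq] at hu hv ⊢
      rw [hs, map_add, map_smul, map_smul]
      exact add_nonneg (mul_nonneg ha hu) (mul_nonneg hb hv))
    (fun s => by
      rcases s.eq_empty_or_nonempty with rfl | hs
      · exact ⟨0, h0B, by simp⟩
      have : Nonempty s := hs.to_subtype
      obtain ⟨w, hw, H⟩ := exists_stdSimplex_forall_nonneg_of_monotone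
        (fun i : s => ((i : B) : E)) (fun i : s => (T (i : B) : E →ₗ[ℝ] ℝ))
        (fun i j => hmono _ _)
      refine ⟨∑ j : s, w j • ((j : B) : E), ?_, ?_⟩
      · exact hBconv.sum_mem (fun i _ => hw.1 i) hw.2 fun i _ => (i : B).2
      · exact Set.mem_iInter₂.2 fun i hi => H ⟨i, hi⟩)
  -- Minty's argument: test with `x + t • (w - x)`, divide by `t` and let `t → 0`.
  have hvar : ∀ w ∈ B, 0 ≤ T x (w - x) := by
    intro w hw
    refine ge_of_tendsto (hemi x (w - x)) ?_
    filter_upwards [Ioc_mem_nhdsGT (zero_lt_one' ℝ)] with t ht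
    have hmem : x + t • (w - x) ∈ B := hBconv.add_smul_sub_mem hxB hw ⟨ht.1.le, ht.2⟩
    have h1 := Set.mem_iInter.1 hx ⟨_, hmem⟩
    simp only [Set.mem_ofPred_eq, add_sub_cancel_left, map_smul, smul_eq_mul] at h1
    exact nonneg_of_mul_nonneg_right h1 ht.1
  have hxR : ‖x‖ < R := by
    refine lt_of_le_of_ne (by simpa [B] using hxB) fun h => ?_
    have h1 := hvar 0 h0B
    have h2 := hcoer x h
    rw [zero_sub, map_neg] at h1
    linarith
  have hnn : ∀ h, 0 ≤ T x h := by
    intro h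
    have hc : Tendsto (fun t : ℝ => ‖x + t • h‖) (𝓝[>] 0) (𝓝 ‖x‖) := by
      have : Continuous (fun t : ℝ => ‖x + t • h‖) := by fun_prop
      simpa using (this.tendsto 0).mono_left nhdsWithin_le_nhds
    obtain ⟨t, ht, ht0⟩ := ((hc.eventually (gt_mem_nhds hxR)).and self_mem_nhdsWithin).exists
    have h1 := hvar (x + t • h) (by simpa [B] using le_of_lt ht)
    rw [add_sub_cancel_left, map_smul, smul_eq_mul] at h1
    exact nonneg_of_mul_nonneg_right h1 ht0
  refine ⟨x, ContinuousLinearMap.ext fun h => le_antisymm ?_ (hnn h)⟩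
  have := hnn (-h)
  rw [map_neg] at this
  simpa using this

/-! ### The sector inequality for `pField` -/

/-- The two estimates behind the scalar sector inequality for nonpositive exponents `q`. With
`r = (m + A) / (m + B)` they are Bernoulli's inequality for `r ^ (-2q)` and for
`(√r) ^ (-2q)`. -/
theorem sub_rpow_mul_bound {m A B q : ℝ} (hm : 0 ≤ m) (hB : 0 < B) (hAB : B < A)
    (hq : -(1 / 2) < q) (hq0 : q ≤ 0) :
    (1 + 2 * q) * ((m + A) ^ q) ^ 2 * (A - B) ≤ ((m + A) ^ q) ^ 2 * A - ((m + B) ^ q) ^ 2 * B ∧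
    ((m + A) ^ q - (m + B) ^ q) ^ 2 * (A * B) ≤ 4 * q ^ 2 * (((m + A) ^ q) ^ 2 * (A - B) ^ 2) := by
  obtain ⟨y, hy⟩ : ∃ y, y = m + B := ⟨_, rfl⟩
  obtain ⟨x, hx⟩ : ∃ x, x = m + A := ⟨_, rfl⟩
  rw [← hx, ← hy]
  have hypos : 0 < y := by linarith
  have hxy : y < x := by linarith
  have hxpos : 0 < x := by linarith
  obtain ⟨r, hr⟩ : ∃ r, r = x / y := ⟨_, rfl⟩
  have hr1 : 1 < r := by rw [hr]; exact (one_lt_div hypos).2 hxy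
  have hrpos : 0 < r := by linarith
  have hry : r * y = x := by rw [hr]; field_simp
  have hryB : (r - 1) * y = A - B := by rw [sub_mul, hry]; linarith
  have hyx : y ^ q = x ^ q * r ^ (-q) := by
    rw [← hry, Real.mul_rpow hrpos.le hypos.le, mul_right_comm, ← Real.rpow_add hrpos]
    simp
  have hxq : 0 < x ^ q := Real.rpow_pos_of_pos hxpos q
  have hrq : 1 ≤ r ^ (-q) := Real.one_le_rpow hr1.le (by linarith)
  obtain ⟨ρ, hρ⟩ : ∃ ρ, ρ = Real.sqrt r := ⟨_, rfl⟩
  have hρ2 : ρ ^ 2 = r := by rw [hρ]; exact Real.sq_sqrt hrpos.le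
  have hρ1 : 1 < ρ := by
    rw [hρ]; exact Real.lt_sqrt_of_sq_lt (by simpa using hr1)
  rw [hyx]
  constructor
  · -- `r^(-2q) ≤ 1 - 2q (r - 1)` by Bernoulli's inequality
    have hb : (r ^ (-q)) ^ 2 ≤ 1 + (-(2 * q)) * (r - 1) := by
      have h := rpow_one_add_le_one_add_mul_self (s := r - 1) (by linarith)
        (p := -(2 * q)) (by linarith) (by linarith)
      rw [add_sub_cancel] at h
      rwa [← Real.rpow_natCast, ← Real.rpow_mul hrpos.le,
        show -q * ((2 : ℕ) : ℝ) = -(2 * q) by push_cast; ring]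
    have hB' : (r - 1) * B ≤ A - B := by
      rw [← hryB]; exact mul_le_mul_of_nonneg_left (by linarith) (by linarith)
    have h2 : (r ^ (-q)) ^ 2 * B ≤ B + (-(2 * q)) * (A - B) := by
      calc (r ^ (-q)) ^ 2 * B ≤ (1 + (-(2 * q)) * (r - 1)) * B :=
            mul_le_mul_of_nonneg_right hb hB.le
        _ = B + (-(2 * q)) * ((r - 1) * B) := by ring
        _ ≤ _ := by
          have := mul_le_mul_of_nonneg_left hB' (by linarith : 0 ≤ -(2 * q))
          linarith
    have h3 := mul_le_mul_of_nonneg_left h2 (sq_nonneg (x ^ q))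
    nlinarith
  · -- `r^(-q) ≤ 1 - 2q (√r - 1)` by Bernoulli's inequality
    have hb : r ^ (-q) ≤ 1 + (-(2 * q)) * (ρ - 1) := by
      have h := rpow_one_add_le_one_add_mul_self (s := ρ - 1) (by linarith)
        (p := -(2 * q)) (by linarith) (by linarith)
      rw [add_sub_cancel] at h
      rwa [← hρ2, ← Real.rpow_natCast, ← Real.rpow_mul (by linarith),
        show ((2 : ℕ) : ℝ) * -q = -(2 * q) by push_cast; ring]
    have h1 : (r ^ (-q) - 1) ^ 2 ≤ 4 * q ^ 2 * (ρ - 1) ^ 2 := by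
      have := pow_le_pow_left₀ (by linarith : 0 ≤ r ^ (-q) - 1)
        (by linarith : r ^ (-q) - 1 ≤ (-(2 * q)) * (ρ - 1)) 2
      linarith [this, (by ring : (-(2 * q) * (ρ - 1)) ^ 2 = 4 * q ^ 2 * (ρ - 1) ^ 2)]
    have h2 : (ρ - 1) ^ 2 * (A * B) ≤ (A - B) ^ 2 := by
      have hxyAB : A * B ≤ x * y :=
        mul_le_mul (by linarith) (by linarith) hB.le hxpos.le
      calc (ρ - 1) ^ 2 * (A * B) ≤ (ρ - 1) ^ 2 * (x * y) :=
            mul_le_mul_of_nonneg_left hxyAB (sq_nonneg _)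
        _ = ((ρ - 1) * ρ * y) ^ 2 := by rw [← hry, ← hρ2]; ring
        _ ≤ ((ρ - 1) * (ρ + 1) * y) ^ 2 := by
          refine pow_le_pow_left₀ ?_ ?_ 2
          · exact mul_nonneg (mul_nonneg (by linarith) (by linarith)) hypos.le
          · exact mul_le_mul_of_nonneg_right
              (mul_le_mul_of_nonneg_left (by linarith) (by linarith)) hypos.le
        _ = (A - B) ^ 2 := by rw [← hryB, ← hρ2]; ring
    calc (x ^ q - x ^ q * r ^ (-q)) ^ 2 * (A * B)
        = (x ^ q) ^ 2 * ((r ^ (-q) - 1) ^ 2 * (A * B)) := by ring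
      _ ≤ (x ^ q) ^ 2 * (4 * q ^ 2 * (ρ - 1) ^ 2 * (A * B)) := by
          have : 0 ≤ A * B := mul_nonneg (by linarith) hB.le
          gcongr
      _ = 4 * q ^ 2 * (x ^ q) ^ 2 * ((ρ - 1) ^ 2 * (A * B)) := by ring
      _ ≤ 4 * q ^ 2 * (x ^ q) ^ 2 * (A - B) ^ 2 := by
          have : 0 ≤ 4 * q ^ 2 * (x ^ q) ^ 2 := by positivity
          exact mul_le_mul_of_nonneg_left h2 this
      _ = _ := by ring

theorem sub_rpow_le_mul {m A B q : ℝ} (hm : 0 ≤ m) (hB : 0 < B) (hAB : B < A) (hq0 : 0 ≤ q) :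
    ((m + A) ^ q - (m + B) ^ q) * B ≤ q * (m + A) ^ q * (A - B) := by
  have hy : 0 < m + B := by linarith
  have hx : 0 < m + A := by linarith
  have h1 : 1 - q * ((A - B) / (m + B)) ≤ (m + B) ^ q / (m + A) ^ q := by
    rw [← Real.div_rpow hy.le hx.le, Real.rpow_def_of_pos (div_pos hy hx)]
    have h2 := Real.log_le_sub_one_of_pos (div_pos hx hy)
    have h3 : Real.log ((m + B) / (m + A)) = - Real.log ((m + A) / (m + B)) := by
      rw [← Real.log_inv, inv_div]
    have h4 : (m + A) / (m + B) - 1 = (A - B) / (m + B) := by field_simp; ring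
    have h5 := Real.add_one_le_exp (Real.log ((m + B) / (m + A)) * q)
    rw [h4] at h2
    rw [h3] at h5 ⊢
    nlinarith [mul_le_mul_of_nonneg_right h2 hq0]
  have hxq : 0 < (m + A) ^ q := Real.rpow_pos_of_pos hx q
  rw [le_div_iff₀ hxq] at h1
  have h6 : (A - B) / (m + B) * B ≤ A - B := by
    rw [div_mul_eq_mul_div, div_le_iff₀ hy]
    nlinarith
  have h7 : ((m + A) ^ q - (m + B) ^ q) * B ≤ (q * ((A - B) / (m + B)) * (m + A) ^ q) * B :=
    mul_le_mul_of_nonneg_right (by linarith) hB.le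
  have h8 := mul_le_mul_of_nonneg_left h6 (mul_nonneg hq0 hxq.le)
  linarith

/-- The function `A ↦ (m + A) ^ (2q) * A` is strictly increasing; equivalently, so is the modulus
`|V(η)|` as a function of `|η|`. -/
theorem rpow_sq_mul_lt {m A B q : ℝ} (hm : 0 ≤ m) (hB : 0 ≤ B) (hAB : B < A)
    (hq : -(1 / 2) < q) : ((m + B) ^ q) ^ 2 * B < ((m + A) ^ q) ^ 2 * A := by
  have hxq : 0 < (m + A) ^ q := Real.rpow_pos_of_pos (by linarith) q
  rcases hB.eq_or_lt with rfl | hB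
  · rw [mul_zero]; positivity
  rcases le_total q 0 with h | h
  · have h1 := (sub_rpow_mul_bound hm hB hAB hq h).1
    have : 0 < (1 + 2 * q) * ((m + A) ^ q) ^ 2 * (A - B) :=
      mul_pos (mul_pos (by linarith) (by positivity)) (by linarith)
    linarith
  · have h1 : (m + B) ^ q ≤ (m + A) ^ q := Real.rpow_le_rpow (by linarith) (by linarith) h
    have h2 : ((m + B) ^ q) ^ 2 ≤ ((m + A) ^ q) ^ 2 :=
      pow_le_pow_left₀ (Real.rpow_nonneg (by linarith) q) h1 2
    calc _ ≤ ((m + A) ^ q) ^ 2 * B := mul_le_mul_of_nonneg_right h2 hB.le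
      _ < _ := mul_lt_mul_of_pos_left hAB (by positivity)

/-- The scalar sector inequality for `f(A) = (m + A) ^ q`. In the application `2 * q + 1 = p - 1`. -/
theorem sub_rpow_sq_mul_le {m A B q κ : ℝ} (hm : 0 ≤ m) (hA : 0 ≤ A) (hB : 0 ≤ B)
    (hq : -(1 / 2) < q) (hκ : 2 * q + 1 ≤ κ) (hκ' : 1 ≤ κ * (2 * q + 1)) :
    ((m + A) ^ q - (m + B) ^ q) ^ 2 * (A * B)
      ≤ (κ ^ 2 - 1) * ((A - B) * (((m + A) ^ q) ^ 2 * A - ((m + B) ^ q) ^ 2 * B)) := by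
  have hκ0 : 0 < κ := by linarith
  have hκ1 : 0 ≤ κ ^ 2 - 1 := by nlinarith
  wlog hAB : B < A generalizing A B
  · rcases (not_lt.1 hAB).eq_or_lt with rfl | h
    · simp
    · have := this hB hA h
      linarith
  rcases hB.eq_or_lt with rfl | hB
  · have := rpow_sq_mul_lt hm le_rfl hAB hq
    simp only [mul_zero, sub_zero] at this ⊢
    positivity
  rcases le_total q 0 with h | h
  · obtain ⟨h1, h2⟩ := sub_rpow_mul_bound hm hB hAB hq h
    have hd : 0 < A - B := by linarith
    have h3 : 4 * q ^ 2 ≤ (κ ^ 2 - 1) * (1 + 2 * q) := by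
      have : 1 ≤ κ ^ 2 * (1 + 2 * q) * (1 + 2 * q) := by nlinarith
      have h6 : 1 ≤ κ ^ 2 * (1 + 2 * q) := by
        nlinarith [mul_nonneg (sq_nonneg κ) (by linarith : 0 ≤ 1 + 2 * q)]
      have h7 : (κ ^ 2 - 1) * (1 + 2 * q) ≥ -(2 * q) := by linarith
      nlinarith
    have h4 := mul_le_mul_of_nonneg_right h3
      (by positivity : 0 ≤ ((m + A) ^ q) ^ 2 * (A - B) ^ 2)
    have h5 := mul_le_mul_of_nonneg_left h1 (mul_nonneg hκ1 hd.le)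
    linarith
  · have h1 := sub_rpow_le_mul hm hB hAB h
    have hxq : 0 < (m + A) ^ q := Real.rpow_pos_of_pos (by linarith) q
    have hyq : 0 < (m + B) ^ q := Real.rpow_pos_of_pos (by linarith) q
    have hle : (m + B) ^ q ≤ (m + A) ^ q := Real.rpow_le_rpow (by linarith) (by linarith) h
    generalize (m + A) ^ q = f at *
    generalize (m + B) ^ q = g at *
    have h2 : q ≤ κ ^ 2 - 1 := by nlinarith
    have hd : 0 < A - B := by linarith
    have h3 : f * A * (f - g) ≤ f ^ 2 * A - g ^ 2 * B := by
      have : g * (g * B) ≤ g * (f * A) :=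
        mul_le_mul_of_nonneg_left (mul_le_mul hle hAB.le hB.le hxq.le) hyq.le
      linarith
    have hA' : 0 ≤ (f - g) * A := mul_nonneg (by linarith) hA
    calc (f - g) ^ 2 * (A * B) = ((f - g) * B) * ((f - g) * A) := by ring
      _ ≤ (q * f * (A - B)) * ((f - g) * A) := mul_le_mul_of_nonneg_right h1 hA'
      _ = q * ((A - B) * (f * A * (f - g))) := by ring
      _ ≤ (κ ^ 2 - 1) * ((A - B) * (f * A * (f - g))) := by
          refine mul_le_mul_of_nonneg_right h2 (mul_nonneg hd.le ?_)
          exact mul_nonneg (mul_nonneg hxq.le hA) (by linarith)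
      _ ≤ _ := mul_le_mul_of_nonneg_left (mul_le_mul_of_nonneg_left h3 hd.le) hκ1

section Matrices

variable {N n : ℕ}

theorem matInner_re (Y Z : CMat N n) : (matInner Y Z).re = inner ℝ Z Y := by
  simp [matInner, PiLp.inner_apply, real_inner_eq_re_inner ℂ]

theorem matInner_smul_left (c : ℂ) (Y Z : CMat N n) : matInner (c • Y) Z = c * matInner Y Z := by
  simp [matInner]

theorem matInner_real_smul_left (c : ℝ) (Y Z : CMat N n) :
    matInner (c • Y) Z = c * matInner Y Z := by
  rw [← matInner_smul_left, Complex.coe_smul]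

theorem norm_matInner_le (Y Z : CMat N n) : ‖matInner Y Z‖ ≤ ‖Y‖ * ‖Z‖ := by
  rw [mul_comm]; exact norm_inner_le_norm Z Y

theorem matInner_sub_sub (c d : ℝ) (Y Z : CMat N n) :
    (matInner (c • Y - d • Z) (Y - Z)).re
        = c * ‖Y‖ ^ 2 + d * ‖Z‖ ^ 2 - (c + d) * (matInner Y Z).re ∧
      (matInner (c • Y - d • Z) (Y - Z)).im = (d - c) * (matInner Y Z).im := by
  have h : matInner (c • Y - d • Z) (Y - Z)
      = c * (‖Y‖ : ℂ) ^ 2 - c * matInner Y Z - d * (starRingEnd ℂ) (matInner Y Z)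
        + d * (‖Z‖ : ℂ) ^ 2 := by
    rw [← Complex.coe_smul c Y, ← Complex.coe_smul d Z]
    simp only [matInner, inner_sub_left, inner_sub_right, inner_smul_right,
      inner_self_eq_norm_sq_to_K,
      inner_conj_symm, Complex.coe_algebraMap]
    ring
  constructor
  · rw [h]; simp [← Complex.ofReal_pow]; ring
  · rw [h]; simp [← Complex.ofReal_pow]; ring

theorem re_matInner_pField_sub_pos {p μ : ℝ} (hp : 1 < p) (Y Z : CMat N n) (hYZ : Y ≠ Z) :
    0 < (matInner (pField p μ Y - pField p μ Z) (Y - Z)).re := by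
  have hq : -(1 / 2) < (p - 2) / 2 := by linarith
  rw [pField, pField, (matInner_sub_sub _ _ Y Z).1]
  have hf : 0 ≤ (μ ^ 2 + ‖Y‖ ^ 2) ^ ((p - 2) / 2) := by positivity
  have hg : 0 ≤ (μ ^ 2 + ‖Z‖ ^ 2) ^ ((p - 2) / 2) := by positivity
  have hr : (matInner Y Z).re ≤ ‖Y‖ * ‖Z‖ := (Complex.re_le_norm _).trans (norm_matInner_le Y Z)
  rcases lt_trichotomy ‖Y‖ ‖Z‖ with h | h | h
  · have h1 := rpow_sq_mul_lt (sq_nonneg μ) (sq_nonneg ‖Y‖)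
      (pow_lt_pow_left₀ h (norm_nonneg _) two_ne_zero) hq
    generalize (μ ^ 2 + ‖Y‖ ^ 2) ^ ((p - 2) / 2) = f at *
    generalize (μ ^ 2 + ‖Z‖ ^ 2) ^ ((p - 2) / 2) = g at *
    have h2 : f * ‖Y‖ < g * ‖Z‖ := lt_of_pow_lt_pow_left₀ 2 (by positivity) (by linarith)
    nlinarith [mul_pos (sub_pos.2 h2) (sub_pos.2 h),
      mul_nonneg (add_nonneg hf hg) (sub_nonneg.2 hr)]
  · rw [← h] at hr hg ⊢
    have hY : 0 < ‖Y‖ := by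
      refine lt_of_le_of_ne (norm_nonneg _) fun h0 => hYZ ?_
      rw [norm_eq_zero.1 h0.symm, norm_eq_zero.1 (h.symm.trans h0.symm)]
    have hf : 0 < (μ ^ 2 + ‖Y‖ ^ 2) ^ ((p - 2) / 2) := by positivity
    have hlt : (matInner Y Z).re < ‖Y‖ * ‖Y‖ := by
      refine lt_of_le_of_ne hr fun h0 => hYZ ?_
      rw [matInner_re, real_inner_comm] at h0
      have := norm_sub_sq_real Y Z
      rw [h0, ← h] at this
      have h3 : ‖Y - Z‖ ^ 2 = 0 := by linarith
      exact sub_eq_zero.1 (norm_eq_zero.1 (pow_eq_zero_iff two_ne_zero |>.1 h3))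
    nlinarith [mul_pos hf (sub_pos.2 hlt)]
  · have h1 := rpow_sq_mul_lt (sq_nonneg μ) (sq_nonneg ‖Z‖)
      (pow_lt_pow_left₀ h (norm_nonneg _) two_ne_zero) hq
    generalize (μ ^ 2 + ‖Y‖ ^ 2) ^ ((p - 2) / 2) = f at *
    generalize (μ ^ 2 + ‖Z‖ ^ 2) ^ ((p - 2) / 2) = g at *
    have h2 : g * ‖Z‖ < f * ‖Y‖ := lt_of_pow_lt_pow_left₀ 2 (by positivity) (by linarith)
    nlinarith [mul_pos (sub_pos.2 h2) (sub_pos.2 h),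
      mul_nonneg (add_nonneg hf hg) (sub_nonneg.2 hr)]

theorem re_matInner_pField_sub_nonneg {p μ : ℝ} (hp : 1 < p) (Y Z : CMat N n) :
    0 ≤ (matInner (pField p μ Y - pField p μ Z) (Y - Z)).re := by
  rcases eq_or_ne Y Z with rfl | h
  · simp [matInner]
  · exact (re_matInner_pField_sub_pos hp Y Z h).le

/-- The sector inequality: the increments `⟨V(Y) - V(Z), Y - Z⟩` lie in a sector around the positive
real axis whose opening is governed by `κ`. -/
theorem abs_im_matInner_pField_sub_le {p μ κ : ℝ} (hp : 1 < p) (hκ : p - 1 ≤ κ)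
    (hκ' : 1 ≤ κ * (p - 1)) (Y Z : CMat N n) :
    |(matInner (pField p μ Y - pField p μ Z) (Y - Z)).im|
      ≤ √(κ ^ 2 - 1) * (matInner (pField p μ Y - pField p μ Z) (Y - Z)).re := by
  have hκ0 : 0 < κ := by linarith
  have hκ1 : 0 ≤ κ ^ 2 - 1 := by nlinarith
  rw [pField, pField, (matInner_sub_sub _ _ Y Z).1, (matInner_sub_sub _ _ Y Z).2]
  have hf : 0 ≤ (μ ^ 2 + ‖Y‖ ^ 2) ^ ((p - 2) / 2) := by positivity
  have hg : 0 ≤ (μ ^ 2 + ‖Z‖ ^ 2) ^ ((p - 2) / 2) := by positivity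
  have key := sub_rpow_sq_mul_le (q := (p - 2) / 2) (κ := κ) (sq_nonneg μ) (sq_nonneg ‖Y‖)
    (sq_nonneg ‖Z‖) (by linarith) (by linarith) (by linarith)
  have hcs : (matInner Y Z).re ^ 2 + (matInner Y Z).im ^ 2 ≤ ‖Y‖ ^ 2 * ‖Z‖ ^ 2 := by
    have h := pow_le_pow_left₀ (norm_nonneg _) (norm_matInner_le Y Z) 2
    rw [← Complex.normSq_eq_norm_sq, Complex.normSq_apply] at h
    linarith
  have hc := Real.sq_sqrt hκ1
  have hc0 := Real.sqrt_nonneg (κ ^ 2 - 1)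
  generalize (μ ^ 2 + ‖Y‖ ^ 2) ^ ((p - 2) / 2) = f at *
  generalize (μ ^ 2 + ‖Z‖ ^ 2) ^ ((p - 2) / 2) = g at *
  rw [← hc] at key
  generalize √(κ ^ 2 - 1) = c at *
  generalize (matInner Y Z).re = r at *
  generalize (matInner Y Z).im = t at *
  have hA := sq_nonneg ‖Y‖
  have hB := sq_nonneg ‖Z‖
  generalize ‖Y‖ ^ 2 = A at *
  generalize ‖Z‖ ^ 2 = B at *
  have hS : 0 ≤ c * (f * A + g * B) := by positivity
  -- The key inequality says `(g - f)² A B ≤ c² ((f A + g B)² - (f + g)² A B)`.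
  have hmain : ((g - f) ^ 2 + (c * (f + g)) ^ 2) * (r ^ 2 + t ^ 2) ≤ (c * (f * A + g * B)) ^ 2 := by
    have h1 := mul_le_mul_of_nonneg_left hcs
      (by positivity : 0 ≤ (g - f) ^ 2 + (c * (f + g)) ^ 2)
    nlinarith
  have hsgn : ∀ d : ℝ, d ^ 2 = (g - f) ^ 2 → d * t + c * (f + g) * r ≤ c * (f * A + g * B) := by
    intro d hd
    refine abs_le_of_sq_le_sq' ?_ hS |>.2
    rw [← hd] at hmain
    nlinarith [sq_nonneg (d * r - c * (f + g) * t)]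
  rw [abs_le]
  have h1 := hsgn (g - f) rfl
  have h2 := hsgn (-(g - f)) (by ring)
  constructor <;> linarith

/-- The sectorial condition on a coefficient `a` compensates for the imaginary part of the increments,
so that multiplication by `a` preserves monotonicity. -/
theorem re_mul_matInner_pField_sub_ge {p μ κ γ : ℝ} (hp : 1 < p) (hκ : p - 1 ≤ κ)
    (hκ' : 1 ≤ κ * (p - 1)) {a : ℂ} (ha : γ < a.re - √(κ ^ 2 - 1) * |a.im|) (Y Z : CMat N n) :
    γ * (matInner (pField p μ Y - pField p μ Z) (Y - Z)).re
      ≤ (a * matInner (pField p μ Y - pField p μ Z) (Y - Z)).re := by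
  have h1 := abs_im_matInner_pField_sub_le (μ := μ) hp hκ hκ' Y Z
  have h2 := re_matInner_pField_sub_nonneg (μ := μ) hp Y Z
  rw [Complex.mul_re]
  generalize (matInner (pField p μ Y - pField p μ Z) (Y - Z)).re = r at *
  generalize (matInner (pField p μ Y - pField p μ Z) (Y - Z)).im = t at *
  have h3 : a.im * t ≤ |a.im| * (√(κ ^ 2 - 1) * r) := by
    calc a.im * t ≤ |a.im * t| := le_abs_self _
      _ = |a.im| * |t| := abs_mul _ _
      _ ≤ _ := mul_le_mul_of_nonneg_left h1 (abs_nonneg _)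
  nlinarith

theorem pField_zero (p μ : ℝ) : pField p μ (0 : CMat N n) = 0 := by simp [pField]

theorem norm_pField {p μ : ℝ} (Y : CMat N n) :
    ‖pField p μ Y‖ = (μ ^ 2 + ‖Y‖ ^ 2) ^ ((p - 2) / 2) * ‖Y‖ := by
  rw [pField, norm_smul, Real.norm_of_nonneg (by positivity)]

theorem norm_pField_le {p μ : ℝ} (hp : 1 < p) (hμ : μ ∈ Set.Icc (0 : ℝ) 1) (Y : CMat N n) :
    ‖pField p μ Y‖ ≤ (1 + ‖Y‖) ^ (p - 1) := by
  rw [norm_pField]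
  rcases (norm_nonneg Y).eq_or_lt with h | h
  · rw [← h]; simp
  rcases le_total 2 p with h2 | h2
  · have h3 : (μ ^ 2 + ‖Y‖ ^ 2) ^ ((p - 2) / 2) ≤ (1 + ‖Y‖) ^ (p - 2) := by
      calc _ ≤ ((1 + ‖Y‖) ^ 2) ^ ((p - 2) / 2) := by
            refine Real.rpow_le_rpow (by positivity) ?_ (by linarith)
            nlinarith [hμ.1, hμ.2]
        _ = _ := by
          rw [← Real.rpow_natCast, ← Real.rpow_mul (by positivity)]
          congr 1; push_cast; ring
    calc _ ≤ (1 + ‖Y‖) ^ (p - 2) * (1 + ‖Y‖) :=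
          mul_le_mul h3 (by linarith) h.le (by positivity)
      _ = _ := by
        rw [← Real.rpow_add_one (by positivity)]
        congr 1; ring
  · have h3 : (μ ^ 2 + ‖Y‖ ^ 2) ^ ((p - 2) / 2) ≤ ‖Y‖ ^ (p - 2) := by
      calc _ ≤ (‖Y‖ ^ 2) ^ ((p - 2) / 2) :=
            Real.rpow_le_rpow_of_nonpos (by positivity) (by nlinarith) (by linarith)
        _ = _ := by
          rw [← Real.rpow_natCast, ← Real.rpow_mul (by positivity)]
          congr 1; push_cast; ring
    calc _ ≤ ‖Y‖ ^ (p - 2) * ‖Y‖ := mul_le_mul_of_nonneg_right h3 h.le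
      _ = ‖Y‖ ^ (p - 1) := by
        rw [← Real.rpow_add_one h.ne']
        congr 1; ring
      _ ≤ _ := Real.rpow_le_rpow h.le (by linarith) (by linarith)

theorem matInner_pField_self (p μ : ℝ) (Y : CMat N n) :
    (matInner (pField p μ Y) Y).re = (μ ^ 2 + ‖Y‖ ^ 2) ^ ((p - 2) / 2) * ‖Y‖ ^ 2 := by
  rw [pField, matInner_real_smul_left, matInner, inner_self_eq_norm_sq_to_K]
  simp [← Complex.ofReal_pow]

theorem rpow_norm_sub_one_le_matInner_pField {p μ : ℝ} (hp : 1 < p) (hμ : μ ∈ Set.Icc (0 : ℝ) 1)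
    (Y : CMat N n) : ‖Y‖ ^ p / 2 - 1 ≤ (matInner (pField p μ Y) Y).re := by
  rw [matInner_pField_self]
  have hpos : 0 ≤ (μ ^ 2 + ‖Y‖ ^ 2) ^ ((p - 2) / 2) * ‖Y‖ ^ 2 := by positivity
  rcases le_total ‖Y‖ 1 with h1 | h1
  · have : ‖Y‖ ^ p ≤ 1 := Real.rpow_le_one (norm_nonneg _) h1 (by linarith)
    linarith
  have h0 : 0 < ‖Y‖ := by linarith
  have hsq : (‖Y‖ ^ 2) ^ ((p - 2) / 2) * ‖Y‖ ^ 2 = ‖Y‖ ^ p := by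
    rw [← Real.rpow_natCast, ← Real.rpow_mul (by positivity), ← Real.rpow_add h0]
    congr 1; push_cast; ring
  have hYp : 0 ≤ ‖Y‖ ^ p := by positivity
  suffices h : ‖Y‖ ^ p / 2 ≤ (μ ^ 2 + ‖Y‖ ^ 2) ^ ((p - 2) / 2) * ‖Y‖ ^ 2 by linarith
  rcases le_total 2 p with h2 | h2
  · have h3 : (‖Y‖ ^ 2) ^ ((p - 2) / 2) ≤ (μ ^ 2 + ‖Y‖ ^ 2) ^ ((p - 2) / 2) :=
      Real.rpow_le_rpow (by positivity) (by nlinarith) (by linarith)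
    have h4 := mul_le_mul_of_nonneg_right h3 (sq_nonneg ‖Y‖)
    rw [hsq] at h4
    linarith
  · have h3 : (2 * ‖Y‖ ^ 2) ^ ((p - 2) / 2) ≤ (μ ^ 2 + ‖Y‖ ^ 2) ^ ((p - 2) / 2) :=
      Real.rpow_le_rpow_of_nonpos (by positivity) (by nlinarith [hμ.1, hμ.2]) (by linarith)
    rw [Real.mul_rpow (by norm_num) (by positivity)] at h3
    have h5 : (1 / 2 : ℝ) ≤ 2 ^ ((p - 2) / 2) := by
      rw [one_div, ← Real.rpow_neg_one]
      exact Real.rpow_le_rpow_of_exponent_le (by norm_num) (by linarith)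
    have h4 := mul_le_mul_of_nonneg_right h3 (sq_nonneg ‖Y‖)
    rw [mul_assoc, hsq] at h4
    have h6 := mul_le_mul_of_nonneg_right h5 hYp
    linarith

theorem continuous_pField {p μ : ℝ} (hp : 1 < p) : Continuous (pField p μ : CMat N n → CMat N n) := by
  rw [continuous_iff_continuousAt]
  intro Y
  -- In the degenerate case `μ = 0`, `Y = 0` continuity comes from `‖V(Z)‖ = ‖Z‖ ^ (p - 1)`.
  by_cases h : μ ^ 2 + ‖Y‖ ^ 2 = 0
  · have hμ0 : μ = 0 := by nlinarith [sq_nonneg μ, sq_nonneg ‖Y‖]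
    have hY0 : Y = 0 := by
      have : ‖Y‖ ^ 2 = 0 := by nlinarith [sq_nonneg μ, sq_nonneg ‖Y‖]
      simpa using this
    subst hμ0 hY0
    rw [ContinuousAt, pField_zero, tendsto_zero_iff_norm_tendsto_zero]
    have h1 : ∀ Z : CMat N n, ‖pField p 0 Z‖ = ‖Z‖ ^ (p - 1) := by
      intro Z
      rw [norm_pField]
      rcases (norm_nonneg Z).eq_or_lt with h | h
      · rw [← h, mul_zero, Real.zero_rpow (by linarith)]
      · rw [zero_pow two_ne_zero, zero_add, ← Real.rpow_natCast, ← Real.rpow_mul h.le,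
          ← Real.rpow_add_one h.ne']
        congr 1; push_cast; ring
    simp only [h1]
    have h2 : ContinuousAt (fun Z : CMat N n => ‖Z‖ ^ (p - 1)) 0 :=
      continuousAt_id.norm.rpow_const (Or.inr (by linarith))
    have := h2.tendsto
    rwa [norm_zero, Real.zero_rpow (by linarith)] at this
  · unfold pField
    have h1 : ContinuousAt (fun Z : CMat N n => (μ ^ 2 + ‖Z‖ ^ 2) ^ ((p - 2) / 2)) Y :=
      ContinuousAt.rpow_const (by fun_prop) (Or.inl h)
    exact h1.smul continuousAt_id

end Matrices

open Filter Topology in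
/-- The structure inequalities along a line, rescaled to `l⁻¹ * t`, `l⁻¹ * s` with `l → 0`: the
parameter `μ` disappears in the limit. -/
theorem IsStructurePair.one_dim {N n : ℕ} (hn : 1 ≤ n) (hN : 1 ≤ N) {p μ c₁ c₂ : ℝ}
    (hc : IsStructurePair N n p μ c₁ c₂) {t s : ℝ} (ht : t ≠ 0) (hs : s ≠ 0) :
    c₁ * (t ^ 2 + s ^ 2) ^ ((p - 2) / 2) * (t - s) ^ 2
        ≤ ((t ^ 2) ^ ((p - 2) / 2) * t - (s ^ 2) ^ ((p - 2) / 2) * s) * (t - s) ∧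
      ((t ^ 2) ^ ((p - 2) / 2) * t - (s ^ 2) ^ ((p - 2) / 2) * s) * (t - s)
        ≤ c₂ * (t ^ 2 + s ^ 2) ^ ((p - 2) / 2) * (t - s) ^ 2 := by
  set q := (p - 2) / 2 with hq
  let e : RMat (2 * N) n := EuclideanSpace.single (⟨0, by omega⟩, ⟨0, by omega⟩) 1
  have he : ‖e‖ = 1 := by simp [e]
  have hne : ∀ r : ℝ, ‖r • e‖ ^ 2 = r ^ 2 := fun r => by
    rw [norm_smul, he, mul_one, Real.norm_eq_abs, sq_abs]
  have hin : ∀ r r' : ℝ, inner ℝ (pField p μ (r • e) - pField p μ (r' • e)) (r • e - r' • e)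
      = ((μ ^ 2 + r ^ 2) ^ q * r - (μ ^ 2 + r' ^ 2) ^ q * r') * (r - r') := by
    intro r r'
    rw [pField, pField, hne, hne, smul_smul, smul_smul, ← sub_smul, ← sub_smul, inner_smul_left,
      inner_smul_right, real_inner_self_eq_norm_sq, he]
    simp [hq]
  have hcont : ∀ b : ℝ, 0 < b → Tendsto (fun l : ℝ => ((μ * l) ^ 2 + b) ^ q) (𝓝[>] 0) (𝓝 (b ^ q)) := by
    intro b hb
    have h1 : ContinuousAt (fun l : ℝ => ((μ * l) ^ 2 + b) ^ q) 0 :=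
      ContinuousAt.rpow_const (by fun_prop) (Or.inl (by simp [hb.ne']))
    have := h1.tendsto.mono_left (nhdsWithin_le_nhds (s := Set.Ioi 0))
    simpa using this
  have hts : 0 < t ^ 2 + s ^ 2 := by positivity
  have hscale : ∀ l b : ℝ, 0 < l → 0 ≤ b →
      (μ ^ 2 + b * (l⁻¹) ^ 2) ^ q = ((μ * l) ^ 2 + b) ^ q * (l⁻¹ ^ 2) ^ q := by
    intro l b hl hb
    rw [← Real.mul_rpow (by positivity) (by positivity)]
    congr 1
    field_simp
  have hM := ((hcont _ (by positivity : 0 < t ^ 2)).mul_const t).sub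
    ((hcont _ (by positivity : 0 < s ^ 2)).mul_const s) |>.mul_const (t - s)
  constructor
  · refine le_of_tendsto_of_tendsto
      (((hcont _ hts).const_mul c₁).mul_const ((t - s) ^ 2)) hM ?_
    filter_upwards [self_mem_nhdsWithin] with l (hl : 0 < l)
    have h := hc.lower ((l⁻¹ * t) • e) ((l⁻¹ * s) • e)
    rw [hin, ← sub_smul, hne, hne, hne, add_assoc,
      show (l⁻¹ * t) ^ 2 + (l⁻¹ * s) ^ 2 = (t ^ 2 + s ^ 2) * l⁻¹ ^ 2 by ring,
      show (l⁻¹ * t) ^ 2 = t ^ 2 * l⁻¹ ^ 2 by ring, show (l⁻¹ * s) ^ 2 = s ^ 2 * l⁻¹ ^ 2 by ring,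
      hscale l _ hl hts.le, hscale l _ hl (sq_nonneg t), hscale l _ hl (sq_nonneg s)] at h
    refine le_of_mul_le_mul_right ?_ (by positivity : 0 < (l⁻¹ ^ 2) ^ q * l⁻¹ ^ 2)
    linarith
  · refine le_of_tendsto_of_tendsto hM
      (((hcont _ hts).const_mul c₂).mul_const ((t - s) ^ 2)) ?_
    filter_upwards [self_mem_nhdsWithin] with l (hl : 0 < l)
    have h := hc.upper ((l⁻¹ * t) • e) ((l⁻¹ * s) • e)
    rw [hin, ← sub_smul, hne, hne, hne, add_assoc,
      show (l⁻¹ * t) ^ 2 + (l⁻¹ * s) ^ 2 = (t ^ 2 + s ^ 2) * l⁻¹ ^ 2 by ring,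
      show (l⁻¹ * t) ^ 2 = t ^ 2 * l⁻¹ ^ 2 by ring, show (l⁻¹ * s) ^ 2 = s ^ 2 * l⁻¹ ^ 2 by ring,
      hscale l _ hl hts.le, hscale l _ hl (sq_nonneg t), hscale l _ hl (sq_nonneg s)] at h
    refine le_of_mul_le_mul_right ?_ (by positivity : 0 < (l⁻¹ ^ 2) ^ q * l⁻¹ ^ 2)
    linarith

open Filter Topology in
/-- The structure inequalities force `c₂ / c₁ ≥ max (p - 1) (1 / (p - 1))`: opposite points `1, -1` give
`c₁ * 2 ^ q ≤ 1 ≤ c₂ * 2 ^ q`, and nearby points on a line give `c₁ * 2 ^ q ≤ p - 1 ≤ c₂ * 2 ^ q`,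
where `q = (p - 2) / 2`. -/
theorem IsStructurePair.ratio_bounds {N n : ℕ} (hn : 1 ≤ n) (hN : 1 ≤ N) {p μ c₁ c₂ : ℝ}
    (hp : 1 < p) (hc : IsStructurePair N n p μ c₁ c₂) :
    p - 1 ≤ c₂ / c₁ ∧ 1 ≤ c₂ / c₁ * (p - 1) := by
  have hone := hc.one_dim hn hN (one_ne_zero) (neg_ne_zero.2 (one_ne_zero' ℝ))
  set q := (p - 2) / 2 with hq
  have e1 : ((1 : ℝ) ^ 2 + (-1) ^ 2) = 2 := by norm_num
  rw [e1] at hone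
  norm_num at hone
  obtain ⟨ha, hb⟩ := hone
  -- the slope of `t ↦ t ^ (p - 1)` at `t = 1`
  have hder : Tendsto (fun t : ℝ => (t - 1)⁻¹ * (t ^ (p - 1) - 1)) (𝓝[>] 1) (𝓝 (p - 1)) := by
    have h := (Real.hasDerivAt_rpow_const (x := 1) (p := p - 1) (Or.inl one_ne_zero))
    have h2 := hasDerivAt_iff_tendsto_slope.1 h
    simp only [Real.one_rpow, mul_one] at h2
    refine (h2.mono_left (nhdsWithin_mono _ fun t (ht : 1 < t) => ht.ne')).congr fun t => ?_
    simp [slope_def_field, div_eq_inv_mul]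
  have hlim : ∀ c : ℝ, Tendsto (fun t : ℝ => c * (t ^ 2 + 1 ^ 2) ^ q) (𝓝[>] 1) (𝓝 (c * 2 ^ q)) := by
    intro c
    have h1 : ContinuousAt (fun t : ℝ => c * (t ^ 2 + 1 ^ 2) ^ q) 1 :=
      continuousAt_const.mul (ContinuousAt.rpow_const (by fun_prop) (Or.inl (by norm_num)))
    have := h1.tendsto.mono_left (nhdsWithin_le_nhds (s := Set.Ioi 1))
    norm_num at this
    simpa using this
  have hpw : ∀ t : ℝ, 1 < t → (t ^ 2) ^ q * t = t ^ (p - 1) := by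
    intro t ht
    have h0 : 0 < t := by linarith
    rw [← Real.rpow_natCast, ← Real.rpow_mul h0.le, ← Real.rpow_add_one h0.ne']
    congr 1; rw [hq]; push_cast; ring
  have hc' : c₁ * 2 ^ q ≤ p - 1 := by
    refine le_of_tendsto_of_tendsto (hlim c₁) hder ?_
    filter_upwards [self_mem_nhdsWithin] with t (ht : 1 < t)
    have h := (hc.one_dim hn hN (by linarith : t ≠ 0) one_ne_zero).1
    rw [← hq, hpw t ht] at h
    simp only [one_pow, Real.one_rpow, mul_one] at h ⊢
    have h0 : 0 < t - 1 := by linarith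
    rw [← div_eq_inv_mul, le_div_iff₀ h0]
    refine le_of_mul_le_mul_right ?_ h0
    linarith
  have hd : p - 1 ≤ c₂ * 2 ^ q := by
    refine le_of_tendsto_of_tendsto hder (hlim c₂) ?_
    filter_upwards [self_mem_nhdsWithin] with t (ht : 1 < t)
    have h := (hc.one_dim hn hN (by linarith : t ≠ 0) one_ne_zero).2
    rw [← hq, hpw t ht] at h
    simp only [one_pow, Real.one_rpow, mul_one] at h ⊢
    have h0 : 0 < t - 1 := by linarith
    rw [← div_eq_inv_mul, div_le_iff₀ h0]
    refine le_of_mul_le_mul_right ?_ h0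
    linarith
  have h2q : (0 : ℝ) < 2 ^ q := by positivity
  have hc1 := hc.pos_left
  have hc2 := hc.pos_right
  constructor
  · rw [le_div_iff₀ hc1]
    refine le_of_mul_le_mul_right ?_ h2q
    nlinarith
  · rw [div_mul_eq_mul_div, le_div_iff₀ hc1]
    refine le_of_mul_le_mul_right ?_ h2q
    nlinarith

/-! ### Uniform convexity of `L^p` -/

theorem norm_half_add_half_rpow_lt {H : Type*} [NormedAddCommGroup H] [NormedSpace ℝ H]
    [StrictConvexSpace ℝ H] {p : ℝ} (hp : 1 < p) {x y : H} (hxy : x ≠ y) :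
    ‖(1 / 2 : ℝ) • x + (1 / 2 : ℝ) • y‖ ^ p < (‖x‖ ^ p + ‖y‖ ^ p) / 2 := by
  have hp0 : 0 < p := by linarith
  by_cases h : ‖x‖ = ‖y‖
  · have h1 : ‖(1 / 2 : ℝ) • x + (1 / 2 : ℝ) • y‖ < ‖y‖ :=
      norm_combo_lt_of_ne h.le le_rfl hxy (by norm_num) (by norm_num) (by norm_num)
    have := Real.rpow_lt_rpow (norm_nonneg _) h1 hp0
    rw [h]; linarith
  · have h1 : ‖(1 / 2 : ℝ) • x + (1 / 2 : ℝ) • y‖ ≤ (1 / 2) * ‖x‖ + (1 / 2) * ‖y‖ := by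
      refine (norm_add_le _ _).trans_eq ?_
      rw [norm_smul, norm_smul]; norm_num
    have h2 := (strictConvexOn_rpow hp).2 (norm_nonneg x) (norm_nonneg y) h
      (by norm_num : (0 : ℝ) < 1 / 2) (by norm_num : (0 : ℝ) < 1 / 2) (by norm_num)
    simp only [smul_eq_mul] at h2
    have := Real.rpow_le_rpow (norm_nonneg _) h1 hp0.le
    linarith

theorem norm_half_add_half_rpow_le {H : Type*} [NormedAddCommGroup H] [NormedSpace ℝ H]
    [StrictConvexSpace ℝ H] {p : ℝ} (hp : 1 < p) (x y : H) :
    ‖(1 / 2 : ℝ) • x + (1 / 2 : ℝ) • y‖ ^ p ≤ (‖x‖ ^ p + ‖y‖ ^ p) / 2 := by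
  rcases eq_or_ne x y with rfl | h
  · rw [← add_smul]; norm_num
  · exact (norm_half_add_half_rpow_lt hp h).le

theorem norm_sub_rpow_le {H : Type*} [NormedAddCommGroup H] [NormedSpace ℝ H] {p : ℝ}
    (hp : 1 < p) (x y : H) : ‖x - y‖ ^ p ≤ 2 ^ p * (‖x‖ ^ p + ‖y‖ ^ p) := by
  have h1 : ‖x - y‖ ≤ 2 * max ‖x‖ ‖y‖ := by
    have := norm_sub_le x y
    have := le_max_left ‖x‖ ‖y‖
    have := le_max_right ‖x‖ ‖y‖
    linarith
  have hx : 0 ≤ ‖x‖ ^ p := by positivity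
  have hy : 0 ≤ ‖y‖ ^ p := by positivity
  have h2 : max ‖x‖ ‖y‖ ^ p ≤ ‖x‖ ^ p + ‖y‖ ^ p := by
    rcases max_choice ‖x‖ ‖y‖ with h | h <;> rw [h] <;> linarith
  calc ‖x - y‖ ^ p ≤ (2 * max ‖x‖ ‖y‖) ^ p :=
        Real.rpow_le_rpow (norm_nonneg _) h1 (by linarith)
    _ = 2 ^ p * max ‖x‖ ‖y‖ ^ p := Real.mul_rpow (by norm_num) (by positivity)
    _ ≤ _ := mul_le_mul_of_nonneg_left h2 (by positivity)

/-- Up to a small error, `‖x - y‖ ^ p` is controlled by the defect of midpoint convexity of `‖·‖ ^ p`.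
By homogeneity and compactness this follows from strict convexity, for all `p > 1` at once. -/
theorem exists_norm_sub_rpow_le {H : Type*} [NormedAddCommGroup H] [NormedSpace ℝ H]
    [StrictConvexSpace ℝ H] [FiniteDimensional ℝ H] {p : ℝ} (hp : 1 < p) {ε : ℝ} (hε : 0 < ε) :
    ∃ C, 0 ≤ C ∧ ∀ x y : H, ‖x - y‖ ^ p ≤ ε * (‖x‖ ^ p + ‖y‖ ^ p)
      + C * ((‖x‖ ^ p + ‖y‖ ^ p) / 2 - ‖(1 / 2 : ℝ) • x + (1 / 2 : ℝ) • y‖ ^ p) := by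
  have hp0 : 0 < p := by linarith
  have : ProperSpace H := FiniteDimensional.proper ℝ H
  set D : H × H → ℝ := fun z =>
    (‖z.1‖ ^ p + ‖z.2‖ ^ p) / 2 - ‖(1 / 2 : ℝ) • z.1 + (1 / 2 : ℝ) • z.2‖ ^ p with hD
  have hD0 : ∀ z, 0 ≤ D z := fun z => sub_nonneg.2 (norm_half_add_half_rpow_le hp _ _)
  have hrp : Continuous fun t : ℝ => t ^ p := Real.continuous_rpow_const hp0.le
  have hDc : Continuous D :=
    ((((hrp.comp continuous_fst.norm).add (hrp.comp continuous_snd.norm)).div_const 2).sub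
      (hrp.comp (by fun_prop : Continuous fun z : H × H =>
        ‖(1 / 2 : ℝ) • z.1 + (1 / 2 : ℝ) • z.2‖)))
  set K : Set (H × H) := {z | ‖z.1‖ ^ p + ‖z.2‖ ^ p = 1 ∧ ε ≤ ‖z.1 - z.2‖ ^ p} with hK
  have hKc : IsCompact K := by
    refine (isCompact_closedBall (0 : H × H) 1).of_isClosed_subset ?_ ?_
    · exact (isClosed_eq ((hrp.comp continuous_fst.norm).add (hrp.comp continuous_snd.norm))
        continuous_const).inter (isClosed_le continuous_const
          (hrp.comp (continuous_fst.sub continuous_snd).norm))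
    · rintro ⟨x, y⟩ ⟨h1, -⟩
      have hx : 0 ≤ ‖x‖ ^ p := by positivity
      have hy : 0 ≤ ‖y‖ ^ p := by positivity
      have key : ∀ t : ℝ, 0 ≤ t → t ^ p ≤ 1 → t ≤ 1 := fun t ht h => by
        by_contra! h'
        exact absurd h (not_le.2 (Real.one_lt_rpow h' hp0))
      simp only [mem_closedBall_zero_iff, Prod.norm_def]
      dsimp only at h1
      exact max_le (key _ (norm_nonneg _) (by linarith)) (key _ (norm_nonneg _) (by linarith))
  have hDpos : ∀ z ∈ K, 0 < D z := by
    rintro ⟨x, y⟩ ⟨-, h2⟩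
    refine sub_pos.2 (norm_half_add_half_rpow_lt hp fun hxy => ?_)
    dsimp only at hxy h2
    simp only [hxy, sub_self, norm_zero, Real.zero_rpow hp0.ne'] at h2
    linarith
  obtain ⟨δ, hδ, hmin⟩ := hKc.exists_forall_le' hDc.continuousOn hDpos
  refine ⟨2 ^ p / δ, by positivity, fun x y => ?_⟩
  have hx : 0 ≤ ‖x‖ ^ p := by positivity
  have hy : 0 ≤ ‖y‖ ^ p := by positivity
  rcases (add_nonneg hx hy).eq_or_lt with h0 | hs
  · have := norm_sub_rpow_le hp x y
    rw [← h0, mul_zero] at this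
    have h3 := mul_nonneg (by positivity : 0 ≤ 2 ^ p / δ) (hD0 (x, y))
    simp only [hD] at h3
    rw [← h0] at h3 ⊢
    linarith
  -- by homogeneity it suffices to treat the normalized pair
  set s := ‖x‖ ^ p + ‖y‖ ^ p with hsdef
  have hc : 0 < s ^ (-p⁻¹) := by positivity
  have hcp : (s ^ (-p⁻¹)) ^ p = s⁻¹ := by
    rw [← Real.rpow_mul hs.le, neg_mul, inv_mul_cancel₀ hp0.ne', Real.rpow_neg_one]
  have hsc : ∀ z : H, ‖s ^ (-p⁻¹) • z‖ ^ p = s⁻¹ * ‖z‖ ^ p := fun z => by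
    rw [norm_smul, Real.mul_rpow (norm_nonneg _) (norm_nonneg _), Real.norm_of_nonneg hc.le, hcp]
  by_cases hz : (s ^ (-p⁻¹) • x, s ^ (-p⁻¹) • y) ∈ K
  · have h1 := hmin _ hz
    simp only [hD] at h1
    rw [smul_comm _ (s ^ (-p⁻¹)) x, smul_comm _ (s ^ (-p⁻¹)) y, ← smul_add, hsc, hsc, hsc] at h1
    have h2 : δ * s ≤ s / 2 - ‖(1 / 2 : ℝ) • x + (1 / 2 : ℝ) • y‖ ^ p := by
      calc δ * s ≤ _ := mul_le_mul_of_nonneg_right h1 hs.le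
        _ = s / 2 - ‖(1 / 2 : ℝ) • x + (1 / 2 : ℝ) • y‖ ^ p := by
          rw [← mul_add, ← hsdef]; field_simp
    have h3 : 2 ^ p * s ≤ 2 ^ p / δ * (s / 2 - ‖(1 / 2 : ℝ) • x + (1 / 2 : ℝ) • y‖ ^ p) := by
      calc 2 ^ p * s = 2 ^ p / δ * (δ * s) := by field_simp
        _ ≤ _ := mul_le_mul_of_nonneg_left h2 (by positivity)
    have h4 := norm_sub_rpow_le hp x y
    have : 0 ≤ ε * s := by positivity
    linarith
  · have h1 : ‖s ^ (-p⁻¹) • x‖ ^ p + ‖s ^ (-p⁻¹) • y‖ ^ p = 1 := by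
      rw [hsc, hsc, ← mul_add, ← hsdef, inv_mul_cancel₀ hs.ne']
    have h2 : ‖s ^ (-p⁻¹) • x - s ^ (-p⁻¹) • y‖ ^ p < ε := by
      by_contra! h
      exact hz ⟨h1, h⟩
    rw [← smul_sub, hsc, inv_mul_lt_iff₀ hs] at h2
    have h3 := mul_nonneg (by positivity : 0 ≤ 2 ^ p / δ) (hD0 (x, y))
    simp only [hD] at h3
    linarith

section Lp

variable {α : Type*} [MeasurableSpace α] {ν : Measure α} {H : Type*} [NormedAddCommGroup H]

theorem integrable_norm_rpow_of_memLp {p : ℝ} (hp : 1 < p) {f : α → H}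
    (hf : MemLp f (ENNReal.ofReal p) ν) : Integrable (fun x => ‖f x‖ ^ p) ν := by
  have h := hf.integrable_norm_rpow (by simpa using by linarith) ENNReal.ofReal_ne_top
  rwa [ENNReal.toReal_ofReal (by linarith)] at h

theorem Lp_norm_rpow_eq_integral {p : ℝ} (hp : 1 < p) (f : Lp H (ENNReal.ofReal p) ν) :
    ‖f‖ ^ p = ∫ x, ‖f x‖ ^ p ∂ν := by
  have hp0 : 0 < p := by linarith
  have h0 : 0 ≤ ∫ x, ‖f x‖ ^ p ∂ν := integral_nonneg fun x => by positivity
  rw [Lp.norm_def, (Lp.memLp f).eLpNorm_eq_integral_rpow_norm (by simpa using hp0)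
    ENNReal.ofReal_ne_top, ENNReal.toReal_ofReal hp0.le, ENNReal.toReal_ofReal (by positivity),
    ← Real.rpow_mul h0, inv_mul_cancel₀ hp0.ne', Real.rpow_one]

/-- Uniform convexity of `‖·‖ ^ p` on the balls of `L^p`. -/
theorem Lp_exists_dist_lt [NormedSpace ℝ H] [StrictConvexSpace ℝ H] [FiniteDimensional ℝ H]
    {p : ℝ} (hp : 1 < p) [Fact (1 ≤ ENNReal.ofReal p)] {R : ℝ} (hR : 0 < R) {ε : ℝ} (hε : 0 < ε) :
    ∃ δ > 0, ∀ f g : Lp H (ENNReal.ofReal p) ν, ‖f‖ ≤ R → ‖g‖ ≤ R →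
      (‖f‖ ^ p + ‖g‖ ^ p) / 2 - ‖(1 / 2 : ℝ) • f + (1 / 2 : ℝ) • g‖ ^ p < δ → dist f g < ε := by
  have hp0 : 0 < p := by linarith
  have hRp : 0 < R ^ p := by positivity
  have hεp : 0 < ε ^ p := by positivity
  obtain ⟨C, hC, H1⟩ := exists_norm_sub_rpow_le (H := H) hp
    (by positivity : 0 < ε ^ p / (4 * R ^ p))
  refine ⟨ε ^ p / (2 * (C + 1)), by positivity, fun f g hf hg hlt => ?_⟩
  have hfi := integrable_norm_rpow_of_memLp hp (Lp.memLp f)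
  have hgi := integrable_norm_rpow_of_memLp hp (Lp.memLp g)
  have hmi := integrable_norm_rpow_of_memLp hp (Lp.memLp ((1 / 2 : ℝ) • f + (1 / 2 : ℝ) • g))
  have hsi := integrable_norm_rpow_of_memLp hp (Lp.memLp (f - g))
  have hai : Integrable (fun x => ‖f x‖ ^ p + ‖g x‖ ^ p) ν := hfi.add hgi
  have hhi : Integrable (fun x => (‖f x‖ ^ p + ‖g x‖ ^ p) / 2) ν := hai.div_const 2
  have hdi : Integrable (fun x => (‖f x‖ ^ p + ‖g x‖ ^ p) / 2
      - ‖((1 / 2 : ℝ) • f + (1 / 2 : ℝ) • g : Lp H (ENNReal.ofReal p) ν) x‖ ^ p) ν := hhi.sub hmi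
  have hle : ‖f - g‖ ^ p ≤ ε ^ p / (4 * R ^ p) * (‖f‖ ^ p + ‖g‖ ^ p)
      + C * ((‖f‖ ^ p + ‖g‖ ^ p) / 2 - ‖(1 / 2 : ℝ) • f + (1 / 2 : ℝ) • g‖ ^ p) := by
    simp only [Lp_norm_rpow_eq_integral hp]
    rw [← integral_add hfi hgi, ← integral_div, ← integral_sub hhi hmi,
      ← integral_const_mul, ← integral_const_mul, ← integral_add (hai.const_mul _)
        (hdi.const_mul _)]
    refine integral_mono_ae hsi ((hai.const_mul _).add (hdi.const_mul _)) ?_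
    filter_upwards [Lp.coeFn_sub f g, Lp.coeFn_add ((1 / 2 : ℝ) • f) ((1 / 2 : ℝ) • g),
      Lp.coeFn_smul (1 / 2 : ℝ) f, Lp.coeFn_smul (1 / 2 : ℝ) g] with x h1 h2 h3 h4
    rw [h1, h2, Pi.add_apply, h3, h4]
    exact H1 (f x) (g x)
  have hfR : ‖f‖ ^ p ≤ R ^ p := Real.rpow_le_rpow (norm_nonneg _) hf hp0.le
  have hgR : ‖g‖ ^ p ≤ R ^ p := Real.rpow_le_rpow (norm_nonneg _) hg hp0.le
  have h1 : ε ^ p / (4 * R ^ p) * (‖f‖ ^ p + ‖g‖ ^ p) ≤ ε ^ p / 2 := by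
    calc _ ≤ ε ^ p / (4 * R ^ p) * (2 * R ^ p) :=
          mul_le_mul_of_nonneg_left (by linarith) (by positivity)
      _ = _ := by field_simp; norm_num
  have h2 : C * ((‖f‖ ^ p + ‖g‖ ^ p) / 2 - ‖(1 / 2 : ℝ) • f + (1 / 2 : ℝ) • g‖ ^ p)
      < ε ^ p / 2 := by
    calc _ ≤ C * (ε ^ p / (2 * (C + 1))) := mul_le_mul_of_nonneg_left hlt.le hC
      _ < (C + 1) * (ε ^ p / (2 * (C + 1))) :=
        mul_lt_mul_of_pos_right (by linarith) (by positivity)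
      _ = _ := by field_simp
  rw [dist_eq_norm]
  exact (Real.rpow_lt_rpow_iff (norm_nonneg _) hε.le hp0).1 (by linarith)

end Lp

/-! ### Jacobian matrices of test functions and the Poincaré inequality -/

section Jacobian

variable {N n : ℕ}

/-- The matrix of a linear map `ℝⁿ → ℂᴺ`; `jacobian φ x` is `fderivToMat (fderiv ℝ φ x)`. -/
noncomputable def fderivToMat : (RVec n →L[ℝ] CVec N) →ₗ[ℝ] CMat N n where
  toFun L := WithLp.toLp 2 fun i : Fin N × Fin n => (L (EuclideanSpace.single i.2 1)) i.1
  map_add' L M := by ext i; simp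
  map_smul' c L := by ext i; simp

theorem jacobian_eq (φ : RVec n → CVec N) (x : RVec n) :
    jacobian φ x = fderivToMat (fderiv ℝ φ x) := rfl

theorem norm_apply_single_le_fderivToMat (L : RVec n →L[ℝ] CVec N) (j : Fin n) :
    ‖L (EuclideanSpace.single j 1)‖ ≤ ‖fderivToMat L‖ := by
  rw [EuclideanSpace.norm_eq, EuclideanSpace.norm_eq, Fintype.sum_prod_type]
  refine Real.sqrt_le_sqrt (Finset.sum_le_sum fun k _ => ?_)
  exact Finset.single_le_sum (f := fun j => ‖(fderivToMat L) (k, j)‖ ^ 2)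
    (fun _ _ => by positivity) (Finset.mem_univ j)

variable {Ω : Opens (RVec n)}

theorem differentiable_testFunction (φ : 𝓓(Ω, CVec N)) : Differentiable ℝ φ :=
  φ.contDiff.differentiable (by simp)

theorem continuous_jacobian (φ : 𝓓(Ω, CVec N)) : Continuous (jacobian φ) :=
  (fderivToMat (N := N) (n := n)).continuous_of_finiteDimensional.comp
    (φ.contDiff.continuous_fderiv (by simp))

theorem hasCompactSupport_jacobian (φ : 𝓓(Ω, CVec N)) : HasCompactSupport (jacobian φ) :=
  (φ.hasCompactSupport.fderiv ℝ).comp_left (g := fderivToMat) (map_zero _)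

theorem memLp_testFunction (q : ℝ≥0∞) (φ : 𝓓(Ω, CVec N)) :
    MemLp φ q (volume.restrict (Ω : Set (RVec n))) :=
  φ.continuous.memLp_of_hasCompactSupport φ.hasCompactSupport

theorem memLp_jacobian (q : ℝ≥0∞) (φ : 𝓓(Ω, CVec N)) :
    MemLp (jacobian φ) q (volume.restrict (Ω : Set (RVec n))) :=
  (continuous_jacobian φ).memLp_of_hasCompactSupport (hasCompactSupport_jacobian φ)

/-- Test functions as elements of `L^p(Ω; ℂᴺ)`. -/
noncomputable def testToLp (q : ℝ≥0∞) :
    𝓓(Ω, CVec N) →ₗ[ℝ] Lp (CVec N) q (volume.restrict (Ω : Set (RVec n))) where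
  toFun φ := (memLp_testFunction q φ).toLp φ
  map_add' _ _ := rfl
  map_smul' _ _ := rfl

/-- The Jacobian matrices of test functions as elements of `L^p(Ω; ℂᴺˣⁿ)`. -/
noncomputable def jacobianToLp (q : ℝ≥0∞) :
    𝓓(Ω, CVec N) →ₗ[ℝ] Lp (CMat N n) q (volume.restrict (Ω : Set (RVec n))) where
  toFun φ := (memLp_jacobian q φ).toLp (jacobian φ)
  map_add' φ ψ := by
    rw [← MemLp.toLp_add]
    congr 1
    ext1 x
    simp only [jacobian_eq, Pi.add_apply, FunLike.coe_add, ← map_add]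
    rw [fderiv_add (differentiable_testFunction φ x) (differentiable_testFunction ψ x)]
  map_smul' c φ := by
    rw [RingHom.id_apply, ← MemLp.toLp_const_smul]
    congr 1
    ext1 x
    simp only [jacobian_eq, Pi.smul_apply, FunLike.coe_smul, ← map_smul]
    rw [fderiv_const_smul (differentiable_testFunction φ x)]

theorem jacobian_I_smul (φ : 𝓓(Ω, CVec N)) :
    jacobian (Complex.I • φ : 𝓓(Ω, CVec N)) = Complex.I • jacobian φ := by
  ext x i
  simp only [jacobian, FunLike.coe_smul]
  rw [fderiv_const_smul (differentiable_testFunction φ x)]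
  simp [jacobian]

/-- The gradients of the functions in `W₀^{1,p}(Ω; ℂᴺ)`: the closure in `L^p` of the Jacobian
matrices of test functions. -/
noncomputable def gradSpace (N : ℕ) (Ω : Opens (RVec n)) (q : ℝ≥0∞) [Fact (1 ≤ q)] :
    Submodule ℝ (Lp (CMat N n) q (volume.restrict (Ω : Set (RVec n)))) :=
  (LinearMap.range (jacobianToLp (N := N) (Ω := Ω) q)).topologicalClosure

theorem I_smul_mem_gradSpace {q : ℝ≥0∞} [Fact (1 ≤ q)]
    {G : Lp (CMat N n) q (volume.restrict (Ω : Set (RVec n)))} (hG : G ∈ gradSpace N Ω q) :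
    Complex.I • G ∈ gradSpace N Ω q := by
  refine map_mem_closure (f := fun G => Complex.I • G) (continuous_const_smul _) hG ?_
  rintro _ ⟨φ, rfl⟩
  refine ⟨Complex.I • φ, ?_⟩
  change MemLp.toLp _ (memLp_jacobian q _) = Complex.I • MemLp.toLp _ (memLp_jacobian q φ)
  rw [← MemLp.toLp_const_smul]
  congr 1
  exact jacobian_I_smul φ

end Jacobian

section Poincare

variable {N n : ℕ} {Ω : Opens (RVec n)}

/-- A form of Young's inequality in which the first term can be absorbed. -/
theorem mul_rpow_mul_le {p K a b : ℝ} (hp : 1 < p) (hK : 0 < K) (ha : 0 ≤ a) (hb : 0 ≤ b) :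
    K * a ^ (p - 1) * b ≤ a ^ p / 2 + (2 * K) ^ p * b ^ p / 2 := by
  have hap : 0 ≤ a ^ p := by positivity
  have hbp : 0 ≤ (2 * K) ^ p * b ^ p := by positivity
  have hsucc : ∀ c : ℝ, 0 ≤ c → c ^ (p - 1) * c = c ^ p := by
    intro c hc
    rcases hc.eq_or_lt with rfl | hc
    · rw [mul_zero, Real.zero_rpow (by linarith)]
    · rw [← Real.rpow_add_one hc.ne']; congr 1; ring
  rcases le_total a (2 * K * b) with h | h
  · have h1 : a ^ (p - 1) ≤ (2 * K * b) ^ (p - 1) := Real.rpow_le_rpow ha h (by linarith)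
    have h2 := mul_le_mul_of_nonneg_right h1 (by positivity : 0 ≤ 2 * K * b)
    rw [hsucc _ (by positivity), Real.mul_rpow (by positivity) hb] at h2
    linarith
  · have h1 := mul_le_mul_of_nonneg_left h (by positivity : 0 ≤ a ^ (p - 1))
    rw [hsucc a ha] at h1
    linarith

/-- The Poincaré inequality for test functions on a subset of a ball of radius `R`. -/
theorem integral_norm_rpow_testFunction_le (hn : 1 ≤ n) {p : ℝ} (hp : 1 < p) {R : ℝ} (hR : 0 < R)
    (hΩ : (Ω : Set (RVec n)) ⊆ Metric.closedBall 0 R) (φ : 𝓓(Ω, CVec N)) :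
    ∫ x in (Ω : Set (RVec n)), ‖φ x‖ ^ p
      ≤ (2 * (R * p)) ^ p * ∫ x in (Ω : Set (RVec n)), ‖jacobian φ x‖ ^ p := by
  have hp0 : 0 < p := by linarith
  let j : Fin n := ⟨0, by omega⟩
  set e : RVec n := EuclideanSpace.single j 1 with he
  have hsupp : ∀ x, x ∉ (Ω : Set (RVec n)) → φ x = 0 := fun x hx =>
    image_eq_zero_of_notMem_tsupport fun h => hx (φ.tsupport_subset h)
  have hφd := differentiable_testFunction φ
  set g : RVec n → ℝ := fun x => ‖φ x‖ ^ p with hg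
  have hgC : ContDiff ℝ 1 g := (φ.contDiff.of_le (by simp)).norm_rpow hp
  have hgs : HasCompactSupport g :=
    φ.hasCompactSupport.comp_left (g := fun v => ‖v‖ ^ p) (by simp [hp0.ne'])
  have hgd : ∀ x, fderiv ℝ g x e = p * ‖φ x‖ ^ (p - 2) * inner ℝ (φ x) (fderiv ℝ φ x e) := by
    intro x
    rw [hg, hφd.fderiv_norm_rpow hp]
    simp
  have hgc' : Continuous fun x => fderiv ℝ g x e :=
    (hgC.continuous_fderiv (by simp)).clm_apply continuous_const
  let f : RVec n →L[ℝ] ℝ := EuclideanSpace.proj j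
  have hfe : f e = 1 := by simp [f, e]
  have hgi : Integrable g := hgC.continuous.integrable_of_hasCompactSupport hgs
  have hfg'i : Integrable fun x => f x * fderiv ℝ g x e :=
    (f.continuous.mul hgc').integrable_of_hasCompactSupport ((hgs.fderiv_apply ℝ e).mul_left)
  have hparts := integral_mul_fderiv_eq_neg_fderiv_mul_of_integrable (μ := (volume : Measure (RVec n)))
    (f := f) (g := g) (v := e)
    (by simpa [hfe] using hgi) hfg'i
    ((f.continuous.mul hgC.continuous).integrable_of_hasCompactSupport hgs.mul_left)
    (fun x _ => f.differentiableAt) (fun x _ => hgC.differentiable (by simp) x)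
  simp only [ContinuousLinearMap.fderiv, hfe, one_mul] at hparts
  have hg0 : ∀ x, x ∉ (Ω : Set (RVec n)) → g x = 0 := fun x hx => by
    simp [hg, hsupp x hx, hp0.ne']
  have hfg0 : ∀ x, x ∉ (Ω : Set (RVec n)) → f x * fderiv ℝ g x e = 0 := fun x hx => by
    rw [hgd, hsupp x hx]; simp
  rw [← setIntegral_eq_integral_of_forall_compl_eq_zero hfg0,
    ← setIntegral_eq_integral_of_forall_compl_eq_zero hg0] at hparts
  have hJi := integrable_norm_rpow_of_memLp hp (memLp_jacobian (ENNReal.ofReal p) φ)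
  have hpt : ∀ x ∈ (Ω : Set (RVec n)), -(f x * fderiv ℝ g x e)
      ≤ g x / 2 + (2 * (R * p)) ^ p * ‖jacobian φ x‖ ^ p / 2 := by
    intro x hx
    have hfx : |f x| ≤ R := by
      have h1 : ‖f x‖ ≤ ‖x‖ := PiLp.norm_apply_le x j
      exact h1.trans (by simpa using hΩ hx)
    have hgx : |fderiv ℝ g x e| ≤ p * ‖φ x‖ ^ (p - 1) * ‖jacobian φ x‖ := by
      rw [hgd, abs_mul, abs_of_nonneg (by positivity : 0 ≤ p * ‖φ x‖ ^ (p - 2))]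
      have h1 : |inner ℝ (φ x) (fderiv ℝ φ x e)| ≤ ‖φ x‖ * ‖jacobian φ x‖ :=
        (abs_real_inner_le_norm _ _).trans
          (mul_le_mul_of_nonneg_left (norm_apply_single_le_fderivToMat _ j) (norm_nonneg _))
      rcases (norm_nonneg (φ x)).eq_or_lt with h | h
      · rw [← h, zero_mul] at h1
        rw [le_antisymm h1 (abs_nonneg _), mul_zero]
        positivity
      · calc _ ≤ p * ‖φ x‖ ^ (p - 2) * (‖φ x‖ * ‖jacobian φ x‖) :=
              mul_le_mul_of_nonneg_left h1 (by positivity)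
          _ = p * (‖φ x‖ ^ (p - 2) * ‖φ x‖) * ‖jacobian φ x‖ := by ring
          _ = _ := by rw [← Real.rpow_add_one h.ne']; congr 3; ring
    calc -(f x * fderiv ℝ g x e) ≤ |f x| * |fderiv ℝ g x e| := by
          rw [← abs_mul]; exact neg_le_abs _
      _ ≤ R * (p * ‖φ x‖ ^ (p - 1) * ‖jacobian φ x‖) :=
          mul_le_mul hfx hgx (abs_nonneg _) hR.le
      _ = R * p * ‖φ x‖ ^ (p - 1) * ‖jacobian φ x‖ := by ring
      _ ≤ _ := mul_rpow_mul_le hp (by positivity) (norm_nonneg _) (norm_nonneg _)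
  have hi1 : Integrable (fun x => g x / 2) (volume.restrict (Ω : Set (RVec n))) :=
    (hgi.div_const 2).restrict
  have hi2 : Integrable (fun x => (2 * (R * p)) ^ p * ‖jacobian φ x‖ ^ p / 2)
      (volume.restrict (Ω : Set (RVec n))) := (hJi.const_mul _).div_const 2
  have hle := setIntegral_mono_on hfg'i.neg.restrict (hi1.add hi2) Ω.isOpen.measurableSet hpt
  simp only [Pi.neg_apply, Pi.add_apply] at hle
  rw [integral_neg, integral_add hi1 hi2, integral_div, integral_div, integral_const_mul,
    hparts] at hle
  linarith

theorem exists_norm_testToLp_le (hn : 1 ≤ n) {p : ℝ} (hp : 1 < p) [Fact (1 ≤ ENNReal.ofReal p)]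
    (hΩ : Bornology.IsBounded (Ω : Set (RVec n))) :
    ∃ C > 0, ∀ φ : 𝓓(Ω, CVec N),
      ‖testToLp (ENNReal.ofReal p) φ‖ ≤ C * ‖jacobianToLp (ENNReal.ofReal p) φ‖ := by
  have hp0 : 0 < p := by linarith
  obtain ⟨R, hR0, hR⟩ := hΩ.subset_closedBall_lt 0 (0 : RVec n)
  refine ⟨2 * (R * p), by positivity, fun φ => ?_⟩
  refine (Real.rpow_le_rpow_iff (norm_nonneg _) (by positivity) hp0).1 ?_
  rw [Real.mul_rpow (by positivity) (norm_nonneg _), Lp_norm_rpow_eq_integral hp,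
    Lp_norm_rpow_eq_integral hp]
  have h1 : ∫ x in (Ω : Set (RVec n)), ‖testToLp (ENNReal.ofReal p) φ x‖ ^ p
      = ∫ x in (Ω : Set (RVec n)), ‖φ x‖ ^ p :=
    integral_congr_ae ((MemLp.coeFn_toLp (memLp_testFunction _ φ)).fun_comp fun v : CVec N => ‖v‖ ^ p)
  have h2 : ∫ x in (Ω : Set (RVec n)), ‖jacobianToLp (ENNReal.ofReal p) φ x‖ ^ p
      = ∫ x in (Ω : Set (RVec n)), ‖jacobian φ x‖ ^ p :=
    integral_congr_ae ((MemLp.coeFn_toLp (memLp_jacobian _ φ)).fun_comp fun v : CMat N n => ‖v‖ ^ p)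
  rw [h1, h2]
  exact integral_norm_rpow_testFunction_le hn hp hR0 hR φ

end Poincare

/-! ### The space `W₀^{1,p}` and its space of gradients -/

section SobolevZero

variable {N n : ℕ} {Ω : Opens (RVec n)}

theorem eLpNorm_rpow_ofReal {α E : Type*} [MeasurableSpace α] {ν : Measure α}
    [NormedAddCommGroup E] {p : ℝ} (hp : 1 < p) (f : α → E) :
    eLpNorm f (ENNReal.ofReal p) ν ^ p = ∫⁻ x, ‖f x‖ₑ ^ p ∂ν := by
  have hp0 : 0 < p := by linarith
  rw [eLpNorm_eq_lintegral_rpow_enorm_toReal (by simpa using hp0) ENNReal.ofReal_ne_top,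
    ENNReal.toReal_ofReal hp0.le, one_div, ENNReal.rpow_inv_rpow hp0.ne']

theorem eLpNorm_le_sobolevNorm {p : ℝ} (hp : 1 < p) (u : RVec n → CVec N) (G : RVec n → CMat N n) :
    eLpNorm u (ENNReal.ofReal p) (volume.restrict (Ω : Set (RVec n))) ≤ sobolevNorm Ω p u G ∧
    eLpNorm G (ENNReal.ofReal p) (volume.restrict (Ω : Set (RVec n))) ≤ sobolevNorm Ω p u G := by
  have hp0 : 0 < p := by linarith
  constructor
  · rw [sobolevNorm, one_div, ENNReal.le_rpow_inv_iff hp0, eLpNorm_rpow_ofReal hp]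
    exact lintegral_mono fun x => le_self_add
  · rw [sobolevNorm, one_div, ENNReal.le_rpow_inv_iff hp0, eLpNorm_rpow_ofReal hp]
    exact lintegral_mono fun x => le_add_self

theorem sobolevNorm_le_add {p : ℝ} (hp : 1 < p) {u : RVec n → CVec N} {G : RVec n → CMat N n}
    (hu : AEStronglyMeasurable u (volume.restrict (Ω : Set (RVec n)))) :
    sobolevNorm Ω p u G ≤ eLpNorm u (ENNReal.ofReal p) (volume.restrict (Ω : Set (RVec n)))
      + eLpNorm G (ENNReal.ofReal p) (volume.restrict (Ω : Set (RVec n))) := by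
  rw [sobolevNorm, lintegral_add_left' (hu.enorm.pow_const p), ← eLpNorm_rpow_ofReal hp,
    ← eLpNorm_rpow_ofReal hp]
  exact ENNReal.rpow_add_rpow_le_add _ _ hp.le

theorem exists_seq_of_hasSobolevZeroGradient {p : ℝ} (hp : 1 < p)
    [Fact (1 ≤ ENNReal.ofReal p)] {u : RVec n → CVec N} {G : RVec n → CMat N n}
    (h : HasSobolevZeroGradient Ω p u G) :
    ∃ φ : ℕ → 𝓓(Ω, CVec N),
      Filter.Tendsto (fun k => testToLp (ENNReal.ofReal p) (φ k)) Filter.atTop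
        (nhds (h.1.memLp.toLp u)) ∧
      Filter.Tendsto (fun k => jacobianToLp (ENNReal.ofReal p) (φ k)) Filter.atTop
        (nhds (h.1.memLp_grad.toLp G)) := by
  choose φ hφ using fun k : ℕ => h.2 ((k : ℝ≥0∞) + 1)⁻¹ (by simp)
  have hlim : Filter.Tendsto (fun k : ℕ => ((k : ℝ≥0∞) + 1)⁻¹) Filter.atTop (nhds 0) := by
    have := ENNReal.tendsto_inv_nat_nhds_zero.comp (Filter.tendsto_add_atTop_nat 1)
    refine this.congr fun k => by simp
  refine ⟨φ, tendsto_iff_edist_tendsto_0.2 ?_, tendsto_iff_edist_tendsto_0.2 ?_⟩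
  · refine tendsto_of_tendsto_of_tendsto_of_le_of_le tendsto_const_nhds hlim (fun _ => zero_le)
      fun k => ?_
    rw [edist_comm]
    refine (Lp.edist_toLp_toLp _ _ _ (memLp_testFunction _ (φ k))).trans_le ?_
    exact (eLpNorm_le_sobolevNorm hp _ _).1.trans (hφ k).le
  · refine tendsto_of_tendsto_of_tendsto_of_le_of_le tendsto_const_nhds hlim (fun _ => zero_le)
      fun k => ?_
    rw [edist_comm]
    refine (Lp.edist_toLp_toLp _ _ _ (memLp_jacobian _ (φ k))).trans_le ?_
    exact (eLpNorm_le_sobolevNorm hp _ _).2.trans (hφ k).le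

theorem toLp_mem_gradSpace {p : ℝ} (hp : 1 < p) [Fact (1 ≤ ENNReal.ofReal p)]
    {u : RVec n → CVec N} {G : RVec n → CMat N n} (h : HasSobolevZeroGradient Ω p u G) :
    h.1.memLp_grad.toLp G ∈ gradSpace N Ω (ENNReal.ofReal p) := by
  obtain ⟨φ, -, hφ⟩ := exists_seq_of_hasSobolevZeroGradient hp h
  exact mem_closure_of_tendsto hφ (Filter.Eventually.of_forall fun k => ⟨φ k, rfl⟩)

/-- The Poincaré inequality in `W₀^{1,p}`, for differences; in particular the gradient determines the
function. -/
theorem exists_norm_toLp_sub_le (hn : 1 ≤ n) {p : ℝ} (hp : 1 < p) [Fact (1 ≤ ENNReal.ofReal p)]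
    (hΩ : Bornology.IsBounded (Ω : Set (RVec n))) :
    ∃ C > 0, ∀ (u v : RVec n → CVec N) (G H : RVec n → CMat N n)
      (hu : HasSobolevZeroGradient Ω p u G) (hv : HasSobolevZeroGradient Ω p v H),
      ‖hu.1.memLp.toLp u - hv.1.memLp.toLp v‖
        ≤ C * ‖hu.1.memLp_grad.toLp G - hv.1.memLp_grad.toLp H‖ := by
  obtain ⟨C, hC, hle⟩ := exists_norm_testToLp_le (N := N) hn hp hΩ
  refine ⟨C, hC, fun u v G H hu hv => ?_⟩
  obtain ⟨φ, h1, h2⟩ := exists_seq_of_hasSobolevZeroGradient hp hu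
  obtain ⟨ψ, h3, h4⟩ := exists_seq_of_hasSobolevZeroGradient hp hv
  refine le_of_tendsto_of_tendsto' (h1.sub h3).norm ((h2.sub h4).norm.const_mul C) fun k => ?_
  rw [← map_sub, ← map_sub]
  exact hle _

theorem integral_fderiv_smul_testFunction (ψ : 𝓓(Ω, ℝ)) (φ : 𝓓(Ω, CVec N)) (k : Fin N)
    (j : Fin n) :
    ∫ x in (Ω : Set (RVec n)), (fderiv ℝ ψ x (EuclideanSpace.single j 1)) • (φ x k)
      = - ∫ x in (Ω : Set (RVec n)), (ψ x) • (jacobian φ x (k, j)) := by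
  set e : RVec n := EuclideanSpace.single j 1
  have hψ0 : ∀ x, x ∉ (Ω : Set (RVec n)) → ψ x = 0 := fun x hx =>
    image_eq_zero_of_notMem_tsupport fun h => hx (ψ.tsupport_subset h)
  have hφ0 : ∀ x, x ∉ (Ω : Set (RVec n)) → φ x = 0 := fun x hx =>
    image_eq_zero_of_notMem_tsupport fun h => hx (φ.tsupport_subset h)
  rw [setIntegral_eq_integral_of_forall_compl_eq_zero fun x hx => by simp [hφ0 x hx],
    setIntegral_eq_integral_of_forall_compl_eq_zero fun x hx => by simp [hψ0 x hx]]
  let P : CVec N →L[ℝ] ℂ := PiLp.proj 2 (fun _ => ℂ) k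
  have hψc : Continuous fun x => fderiv ℝ ψ x e :=
    (ψ.contDiff.continuous_fderiv (by simp)).clm_apply continuous_const
  have hφc : Continuous fun x => fderiv ℝ φ x e :=
    (φ.contDiff.continuous_fderiv (by simp)).clm_apply continuous_const
  have hPφ : ∀ x, fderiv ℝ (fun x => P (φ x)) x e = P (fderiv ℝ φ x e) := fun x => by
    have := (P.hasFDerivAt.comp x (differentiable_testFunction φ x).hasFDerivAt).fderiv
    rw [show (fun x => P (φ x)) = P ∘ φ from rfl, this]
    rfl
  have hcs := φ.hasCompactSupport.comp_left (g := P) (map_zero P)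
  have hparts := integral_bilinear_fderiv_right_eq_neg_left_of_integrable
    (μ := (volume : Measure (RVec n))) (B := ContinuousLinearMap.lsmul ℝ ℝ)
    (f := ψ) (g := fun x => P (φ x)) (v := e)
    ((hψc.smul (P.continuous.comp φ.continuous)).integrable_of_hasCompactSupport
      (ψ.hasCompactSupport.fderiv_apply ℝ e).smul_right)
    (by
      simp only [hPφ]
      exact (ψ.continuous.smul (P.continuous.comp hφc)).integrable_of_hasCompactSupport
        ψ.hasCompactSupport.smul_right)
    ((ψ.continuous.smul (P.continuous.comp φ.continuous)).integrable_of_hasCompactSupport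
      ψ.hasCompactSupport.smul_right)
    (fun x _ => ψ.contDiff.differentiable (by simp) x)
    (fun x _ => P.differentiableAt.comp x (differentiable_testFunction φ x))
  simp only [hPφ, ContinuousLinearMap.lsmul_apply] at hparts
  exact neg_eq_iff_eq_neg.1 hparts.symm |>.symm ▸ rfl

theorem continuous_integral_smul_coord {ι : Type*} [Fintype ι] {p q : ℝ≥0∞} [Fact (1 ≤ p)]
    [Fact (1 ≤ q)] [q.HolderConjugate p] {w : RVec n → ℝ}
    (hw : MemLp w q (volume.restrict (Ω : Set (RVec n)))) (i : ι) :
    Continuous fun u : Lp (EuclideanSpace ℂ ι) p (volume.restrict (Ω : Set (RVec n))) =>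
      ∫ x in (Ω : Set (RVec n)), w x • u x i := by
  let B : ℝ →L[ℝ] EuclideanSpace ℂ ι →L[ℝ] ℂ :=
    (ContinuousLinearMap.lsmul ℝ ℝ).bilinearComp (.id ℝ ℝ) (PiLp.proj 2 (fun _ => ℂ) i)
  refine (B.lpPairing (volume.restrict (Ω : Set (RVec n))) q p (hw.toLp w)).continuous.congr
    fun u => ?_
  rw [ContinuousLinearMap.lpPairing_eq_integral]
  refine integral_congr_ae ?_
  filter_upwards [hw.coeFn_toLp] with x hx
  rw [hx]
  rfl

/-- Every element of `gradSpace` is the gradient of a function in `W₀^{1,p}`: by the Poincaré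
inequality, test functions whose Jacobian matrices converge in `L^p` converge themselves. -/
theorem exists_hasSobolevZeroGradient (hn : 1 ≤ n) {p : ℝ} (hp : 1 < p)
    [Fact (1 ≤ ENNReal.ofReal p)] (hΩ : Bornology.IsBounded (Ω : Set (RVec n)))
    {G : Lp (CMat N n) (ENNReal.ofReal p) (volume.restrict (Ω : Set (RVec n)))}
    (hG : G ∈ gradSpace N Ω (ENNReal.ofReal p)) :
    ∃ u : Lp (CVec N) (ENNReal.ofReal p) (volume.restrict (Ω : Set (RVec n))),
      HasSobolevZeroGradient Ω p u G := by
  obtain ⟨C, hC, H⟩ := exists_norm_testToLp_le (N := N) hn hp hΩ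
  obtain ⟨g, hg, hlim⟩ := mem_closure_iff_seq_limit.1 hG
  choose φ hφ using hg
  obtain rfl : g = fun k => jacobianToLp (ENNReal.ofReal p) (φ k) := funext fun k => (hφ k).symm
  have hcau : CauchySeq fun k => testToLp (ENNReal.ofReal p) (φ k) := by
    refine Metric.cauchySeq_iff.2 fun ε hε => ?_
    obtain ⟨K, hK⟩ := Metric.cauchySeq_iff.1 hlim.cauchySeq (ε / C) (by positivity)
    refine ⟨K, fun i hi l hl => ?_⟩
    have h1 := hK i hi l hl
    rw [dist_eq_norm, ← map_sub, lt_div_iff₀' hC] at h1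
    rw [dist_eq_norm, ← map_sub]
    exact (H _).trans_lt h1
  obtain ⟨u, hu⟩ := cauchySeq_tendsto_of_complete hcau
  have hq := Real.HolderConjugate.conjExponent hp
  have := hq.symm.ennrealOfReal
  have : Fact (1 ≤ ENNReal.ofReal (Real.conjExponent p)) :=
    ⟨by simpa using hq.symm.lt.le⟩
  refine ⟨u, ⟨Lp.memLp u, Lp.memLp G, fun ψ k j => ?_⟩, fun ε hε => ?_⟩
  · have hψ : MemLp (fun x => fderiv ℝ ψ x (EuclideanSpace.single j 1))
        (ENNReal.ofReal (Real.conjExponent p)) (volume.restrict (Ω : Set (RVec n))) :=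
      ((ψ.contDiff.continuous_fderiv (by simp)).clm_apply
        continuous_const).memLp_of_hasCompactSupport (ψ.hasCompactSupport.fderiv_apply ℝ _)
    have hψ' : MemLp ψ
        (ENNReal.ofReal (Real.conjExponent p)) (volume.restrict (Ω : Set (RVec n))) :=
      ψ.continuous.memLp_of_hasCompactSupport ψ.hasCompactSupport
    refine tendsto_nhds_unique (((continuous_integral_smul_coord hψ k).tendsto u).comp hu)
      ((((continuous_integral_smul_coord hψ' (k, j)).tendsto G).comp hlim).neg.congr fun m => ?_)
    have h1 : ∫ x in (Ω : Set (RVec n)), (fderiv ℝ ψ x (EuclideanSpace.single j 1)) •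
        (testToLp (ENNReal.ofReal p) (φ m) x k)
        = ∫ x in (Ω : Set (RVec n)), (fderiv ℝ ψ x (EuclideanSpace.single j 1)) • (φ m x k) := by
      refine integral_congr_ae ?_
      filter_upwards [(memLp_testFunction (ENNReal.ofReal p) (φ m)).coeFn_toLp] with x hx
      change _ • (((memLp_testFunction (ENNReal.ofReal p) (φ m)).toLp _ x) k) = _
      rw [hx]
    have h2 : ∫ x in (Ω : Set (RVec n)), (ψ x) • (jacobianToLp (ENNReal.ofReal p) (φ m) x (k, j))
        = ∫ x in (Ω : Set (RVec n)), (ψ x) • (jacobian (φ m) x (k, j)) := by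
      refine integral_congr_ae ?_
      filter_upwards [(memLp_jacobian (ENNReal.ofReal p) (φ m)).coeFn_toLp] with x hx
      change _ • (((memLp_jacobian (ENNReal.ofReal p) (φ m)).toLp _ x) (k, j)) = _
      rw [hx]
    simp only [Function.comp_apply]
    rw [h1, h2, integral_fderiv_smul_testFunction]
  · have h1 := (tendsto_iff_edist_tendsto_0.1 hu).add (tendsto_iff_edist_tendsto_0.1 hlim)
    rw [add_zero] at h1
    obtain ⟨m, hm⟩ := (h1.eventually (gt_mem_nhds hε)).exists
    refine ⟨φ m, (sobolevNorm_le_add hp ?_).trans_lt (lt_of_eq_of_lt ?_ hm)⟩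
    · exact (Lp.aestronglyMeasurable u).sub (memLp_testFunction (ENNReal.ofReal p) (φ m)).1
    · rw [edist_comm _ u, edist_comm _ G, Lp.edist_def, Lp.edist_def]
      congr 1
      · refine eLpNorm_congr_ae ?_
        filter_upwards [(memLp_testFunction (ENNReal.ofReal p) (φ m)).coeFn_toLp] with x hx
        exact congrArg (u x - ·) hx.symm
      · refine eLpNorm_congr_ae ?_
        filter_upwards [(memLp_jacobian (ENNReal.ofReal p) (φ m)).coeFn_toLp] with x hx
        exact congrArg (G x - ·) hx.symm

end SobolevZero

/-! ### The flux and the weak solution -/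

section Flux

variable {N n : ℕ} {α : Type*} [MeasurableSpace α] {ν : Measure α}

theorem re_integral_matInner {W H : α → CMat N n} (h : Integrable (fun x => matInner (W x) (H x)) ν) :
    (∫ x, matInner (W x) (H x) ∂ν).re = ∫ x, inner ℝ (W x) (H x) ∂ν := by
  have := (Complex.reCLM.integral_comp_comm h).symm
  simp only [Complex.reCLM_apply, matInner_re] at this
  rw [this]
  exact integral_congr_ae (.of_forall fun x => real_inner_comm _ _)

/-- The imaginary part of the pairing is the real part of the pairing with `i H`. -/
theorem im_integral_matInner {W H : α → CMat N n} (h : Integrable (fun x => matInner (W x) (H x)) ν) :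
    (∫ x, matInner (W x) (H x) ∂ν).im = ∫ x, inner ℝ (W x) (Complex.I • H x) ∂ν := by
  have := (Complex.imCLM.integral_comp_comm h).symm
  simp only [Complex.imCLM_apply] at this
  rw [this]
  refine integral_congr_ae (.of_forall fun x => ?_)
  dsimp only
  rw [real_inner_comm, ← matInner_re]
  simp [matInner]

theorem integrable_matInner {p q : ℝ≥0∞} [q.HolderConjugate p] {W H : α → CMat N n}
    (hW : MemLp W q ν) (hH : MemLp H p ν) : Integrable (fun x => matInner (W x) (H x)) ν := by
  refine Integrable.mono' (hW.norm.integrable_mul hH.norm) ?_ (.of_forall fun x => ?_)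
  · exact hH.1.inner hW.1
  · exact norm_matInner_le _ _

theorem memLp_rpow_one_add_norm {E : Type*} [NormedAddCommGroup E] [IsFiniteMeasure ν] {p : ℝ}
    (hp : 1 < p) {G : α → E}
    (hG : MemLp G (ENNReal.ofReal p) ν) :
    MemLp (fun x => (1 + ‖G x‖) ^ (p - 1)) (ENNReal.ofReal (Real.conjExponent p)) ν := by
  have h1 : MemLp (fun x => 1 + ‖G x‖) (ENNReal.ofReal p) ν :=
    MemLp.add (f := fun _ => (1 : ℝ)) (memLp_const 1) hG.norm
  have h2 := h1.norm_rpow_div (ENNReal.ofReal (p - 1))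
  rw [ENNReal.toReal_ofReal (by linarith), ← ENNReal.ofReal_div_of_pos (by linarith)] at h2
  refine h2.congr_norm ?_ (.of_forall fun x => ?_)
  · exact (h1.1.aemeasurable.pow_const _).aestronglyMeasurable
  · rw [Real.norm_of_nonneg (by positivity : 0 ≤ 1 + ‖G x‖)]

/-- The flux `a V(G)` lies in the dual Lebesgue space, as `|V(η)| ≤ (1 + |η|) ^ (p - 1)`. -/
theorem memLp_smul_pField [IsFiniteMeasure ν] {p μ γ : ℝ} (hp : 1 < p)
    (hμ : μ ∈ Set.Icc (0 : ℝ) 1) {a : α → ℂ} (ha : AEStronglyMeasurable a ν)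
    (haγ : ∀ᵐ x ∂ν, ‖a x‖ ≤ γ) {G : α → CMat N n} (hG : MemLp G (ENNReal.ofReal p) ν) :
    MemLp (fun x => a x • pField p μ (G x)) (ENNReal.ofReal (Real.conjExponent p)) ν := by
  refine ((memLp_rpow_one_add_norm hp hG).const_mul γ).mono'
    (ha.smul ((continuous_pField hp).comp_aestronglyMeasurable hG.1)) ?_
  filter_upwards [haγ] with x hx
  rw [norm_smul]
  exact mul_le_mul hx (norm_pField_le hp hμ _) (norm_nonneg _) ((norm_nonneg _).trans hx)

theorem memLp_rpow_smul [IsFiniteMeasure ν] {p : ℝ} (hp : 1 < p) {F : α → CMat N n}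
    (hF : MemLp F (ENNReal.ofReal p) ν) :
    MemLp (fun x => (‖F x‖ ^ (p - 2)) • F x) (ENNReal.ofReal (Real.conjExponent p)) ν := by
  -- The right-hand side is the flux for `μ = 0` and the constant coefficient `1`.
  have h : (fun x => (‖F x‖ ^ (p - 2)) • F x) = fun x => (1 : ℂ) • pField p 0 (F x) := by
    ext1 x
    rw [one_smul, pField, zero_pow two_ne_zero, zero_add, ← Real.rpow_natCast,
      ← Real.rpow_mul (norm_nonneg _)]
    congr 2; push_cast; ring
  rw [h]
  exact memLp_smul_pField (a := fun _ => 1) (γ := 1) hp (by simp) aestronglyMeasurable_const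
    (by simp) hF

/-- The `L^p`-pairing `H ↦ ∫ Re ⟨W, H⟩` with a function `W` in the dual Lebesgue space. -/
noncomputable def fluxFunctional {p q : ℝ≥0∞} [Fact (1 ≤ p)] [Fact (1 ≤ q)] [q.HolderConjugate p]
    {W : α → CMat N n} (hW : MemLp W q ν) : Lp (CMat N n) p ν →L[ℝ] ℝ :=
  (innerSL ℝ : CMat N n →L[ℝ] CMat N n →L[ℝ] ℝ).lpPairing ν q p (hW.toLp W)

theorem fluxFunctional_apply {p q : ℝ≥0∞} [Fact (1 ≤ p)] [Fact (1 ≤ q)] [q.HolderConjugate p]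
    {W : α → CMat N n} (hW : MemLp W q ν) (H : Lp (CMat N n) p ν) :
    fluxFunctional hW H = ∫ x, inner ℝ (W x) (H x) ∂ν := by
  rw [fluxFunctional, ContinuousLinearMap.lpPairing_eq_integral]
  refine integral_congr_ae ?_
  filter_upwards [hW.coeFn_toLp] with x hx
  rw [hx]
  rfl

theorem integrable_real_inner {p q : ℝ≥0∞} [q.HolderConjugate p] {W H : α → CMat N n}
    (hW : MemLp W q ν) (hH : MemLp H p ν) : Integrable (fun x => inner ℝ (W x) (H x)) ν := by
  refine (integrable_matInner hW hH).re.congr (.of_forall fun x => ?_)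
  dsimp only
  rw [real_inner_comm, ← matInner_re]
  rfl

theorem real_inner_smul_pField_sub (a : ℂ) (p μ : ℝ) (Y Z : CMat N n) :
    inner ℝ (a • pField p μ Y - a • pField p μ Z) (Y - Z)
      = (a * matInner (pField p μ Y - pField p μ Z) (Y - Z)).re := by
  rw [← matInner_smul_left, smul_sub, matInner_re, real_inner_comm]

open Filter Topology in
/-- Solvability of the real part of the equation in a closed subspace `V` of `L^p`, with an arbitrary
right-hand side `W` in the dual Lebesgue space. -/
theorem exists_flux_eq [IsFiniteMeasure ν] {p μ κ γ₀ γ₂ : ℝ} (hp : 1 < p)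
    (hμ : μ ∈ Set.Icc (0 : ℝ) 1) (hκ : p - 1 ≤ κ) (hκ' : 1 ≤ κ * (p - 1)) (hγ₀ : 0 < γ₀)
    [Fact (1 ≤ ENNReal.ofReal p)] [Fact (1 ≤ ENNReal.ofReal (Real.conjExponent p))]
    [(ENNReal.ofReal (Real.conjExponent p)).HolderConjugate (ENNReal.ofReal p)]
    {a : α → ℂ} (ha : AEStronglyMeasurable a ν) (haγ : ∀ᵐ x ∂ν, ‖a x‖ ≤ γ₂)
    (has : ∀ᵐ x ∂ν, γ₀ < (a x).re - √(κ ^ 2 - 1) * |(a x).im|)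
    {V : Submodule ℝ (Lp (CMat N n) (ENNReal.ofReal p) ν)} (hV : IsClosed (V : Set (Lp (CMat N n) (ENNReal.ofReal p) ν)))
    {W : α → CMat N n} (hW : MemLp W (ENNReal.ofReal (Real.conjExponent p)) ν) :
    ∃ G ∈ V, ∀ H ∈ V, ∫ x, inner ℝ (a x • pField p μ (G x)) (H x) ∂ν
      = ∫ x, inner ℝ (W x) (H x) ∂ν := by
  have : CompleteSpace V := hV.completeSpace_coe
  have hp0 : 0 < p := by linarith
  have hA : ∀ G : Lp (CMat N n) (ENNReal.ofReal p) ν, MemLp (fun x => a x • pField p μ (G x))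
      (ENNReal.ofReal (Real.conjExponent p)) ν := fun G =>
    memLp_smul_pField hp hμ ha haγ (Lp.memLp G)
  set ℓ : Lp (CMat N n) (ENNReal.ofReal p) ν →L[ℝ] ℝ := fluxFunctional hW with hℓ
  let S : Lp (CMat N n) (ENNReal.ofReal p) ν → Lp (CMat N n) (ENNReal.ofReal p) ν →L[ℝ] ℝ :=
    fun G => fluxFunctional (hA G)
  have hS : ∀ G H, S G H = ∫ x, inner ℝ (a x • pField p μ (G x)) (H x) ∂ν := fun G H =>
    fluxFunctional_apply (hA G) H
  have hSi : ∀ G H : Lp (CMat N n) (ENNReal.ofReal p) ν,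
      Integrable (fun x => inner ℝ (a x • pField p μ (G x)) (H x)) ν := fun G H =>
    integrable_real_inner (hA G) (Lp.memLp H)
  have hmono : ∀ G H, 0 ≤ (S G - S H) (G - H) := by
    intro G H
    rw [sub_apply, hS, hS, ← integral_sub (hSi G _) (hSi H _)]
    refine integral_nonneg_of_ae ?_
    filter_upwards [Lp.coeFn_sub G H, has] with x hx hax
    rw [hx, Pi.sub_apply, ← inner_sub_left, real_inner_smul_pField_sub]
    exact (mul_nonneg hγ₀.le (re_matInner_pField_sub_nonneg hp _ _)).trans
      (re_mul_matInner_pField_sub_ge hp hκ hκ' hax _ _)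
  have hcoer : ∀ G, γ₀ / 2 * ‖G‖ ^ p - γ₀ * ν.real Set.univ ≤ S G G := by
    intro G
    rw [hS, Lp_norm_rpow_eq_integral hp]
    have hGi := integrable_norm_rpow_of_memLp hp (Lp.memLp G)
    have e : γ₀ / 2 * ∫ x, ‖G x‖ ^ p ∂ν - γ₀ * ν.real Set.univ
        = ∫ x, (γ₀ / 2 * ‖G x‖ ^ p - γ₀) ∂ν := by
      rw [integral_sub (hGi.const_mul _) (integrable_const _), integral_const_mul, integral_const,
        smul_eq_mul, mul_comm γ₀ (ν.real _)]
    rw [e]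
    refine integral_mono_ae ((hGi.const_mul _).sub (integrable_const _)) (hSi G G) ?_
    filter_upwards [has] with x hax
    have h1 := re_mul_matInner_pField_sub_ge (μ := μ) hp hκ hκ' hax (G x) 0
    rw [← real_inner_smul_pField_sub, pField_zero, smul_zero, sub_zero, sub_zero, sub_zero] at h1
    have h2 := rpow_norm_sub_one_le_matInner_pField hp hμ (G x)
    have h3 := mul_le_mul_of_nonneg_left h2 hγ₀.le
    linarith
  have hhemi : ∀ G H, Tendsto (fun t : ℝ => S (G + t • H) H) (𝓝[>] 0) (𝓝 (S G H)) := by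
    intro G H
    have e : ∀ t : ℝ, S (G + t • H) H
        = ∫ x, inner ℝ (a x • pField p μ (G x + t • H x)) (H x) ∂ν := by
      intro t
      rw [hS]
      refine integral_congr_ae ?_
      filter_upwards [Lp.coeFn_add G (t • H), Lp.coeFn_smul t H] with x h1 h2
      rw [h1, Pi.add_apply, h2, Pi.smul_apply]
    simp only [e]
    rw [hS]
    have hb := memLp_rpow_one_add_norm hp ((Lp.memLp G).norm.add (Lp.memLp H).norm)
    refine tendsto_integral_filter_of_dominated_convergence
      (fun x => γ₂ * (1 + ‖‖G x‖ + ‖H x‖‖) ^ (p - 1) * ‖H x‖) (.of_forall fun t => ?_) ?_ ?_ ?_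
    · exact ((ha.smul ((continuous_pField hp).comp_aestronglyMeasurable
        ((Lp.aestronglyMeasurable G).add ((Lp.aestronglyMeasurable H).const_smul t)))).inner
          (Lp.aestronglyMeasurable H))
    · filter_upwards [Ioc_mem_nhdsGT (zero_lt_one' ℝ)] with t ht
      filter_upwards [haγ] with x hx
      refine (norm_inner_le_norm _ _).trans (mul_le_mul_of_nonneg_right ?_ (norm_nonneg _))
      rw [norm_smul]
      refine mul_le_mul hx ((norm_pField_le hp hμ _).trans ?_) (norm_nonneg _)
        ((norm_nonneg _).trans hx)
      refine Real.rpow_le_rpow (by positivity) ?_ (by linarith)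
      have h1 := norm_add_le (G x) (t • H x)
      rw [norm_smul, Real.norm_of_nonneg ht.1.le] at h1
      have h2 : t * ‖H x‖ ≤ 1 * ‖H x‖ := mul_le_mul_of_nonneg_right ht.2 (norm_nonneg _)
      rw [Real.norm_of_nonneg (by positivity)]
      linarith
    · exact (hb.const_mul γ₂).integrable_mul (Lp.memLp H).norm
    · refine .of_forall fun x => ?_
      have hc : Continuous fun t : ℝ => inner ℝ (a x • pField p μ (G x + t • H x)) (H x) :=
        (((continuous_pField hp).comp (by fun_prop : Continuous fun t : ℝ => G x + t • H x)).const_smul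
          (a x)).inner continuous_const
      have := (hc.tendsto 0).mono_left (nhdsWithin_le_nhds (s := Set.Ioi 0))
      simpa using this
  -- a radius at which the superlinear term `γ₀ / 2 * R ^ p` beats the lower order terms
  obtain ⟨R, hR1, hR⟩ : ∃ R : ℝ, 1 ≤ R ∧ γ₀ * ν.real Set.univ + ‖ℓ‖ * R < γ₀ / 2 * R ^ p := by
    have h1 : Tendsto (fun R : ℝ => γ₀ / 2 * R ^ (p - 1)) atTop atTop :=
      (tendsto_rpow_atTop (by linarith)).const_mul_atTop (by positivity)
    obtain ⟨R, hR, hR1⟩ := ((h1.eventually_gt_atTop (γ₀ * ν.real Set.univ + ‖ℓ‖)).and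
      (eventually_ge_atTop 1)).exists
    refine ⟨R, hR1, ?_⟩
    have h0 : 0 < R := by linarith
    have h2 := mul_lt_mul_of_pos_right hR h0
    have h3 : R ^ (p - 1) * R = R ^ p := by
      rw [← Real.rpow_add_one h0.ne']; congr 1; ring
    have h4 : 0 ≤ γ₀ * ν.real Set.univ := by positivity
    nlinarith
  have hR0 : 0 < R := by linarith
  obtain ⟨G, hG⟩ := exists_eq_zero_of_monotone_of_coercive (E := V) hR0
    (Φ := fun G => ‖G‖ ^ p) (M := R ^ p) (fun G _ => by positivity)
    (fun G hG => Real.rpow_le_rpow (norm_nonneg _) (by simpa using hG) hp0.le)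
    (fun ε hε => by
      obtain ⟨δ, hδ, H⟩ := Lp_exists_dist_lt (ν := ν) (H := CMat N n) hp hR0 hε
      exact ⟨δ, hδ, fun G hG K hK h => H G K (by simpa using hG) (by simpa using hK) h⟩)
    (fun G => (S G - ℓ).comp V.subtypeL)
    (fun G H => by
      have := hmono G H
      simpa using this)
    (fun G H => by
      have := (hhemi G H).sub_const (ℓ H)
      simpa using this)
    (fun G hG => by
      have h1 := hcoer G
      have h2 : ℓ G ≤ ‖ℓ‖ * ‖(G : Lp (CMat N n) (ENNReal.ofReal p) ν)‖ :=
        (le_abs_self _).trans (ℓ.le_opNorm _)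
      have hG' : ‖(G : Lp (CMat N n) (ENNReal.ofReal p) ν)‖ = R := hG
      rw [hG'] at h1 h2
      simp only [ContinuousLinearMap.comp_apply, sub_apply,
        Submodule.subtypeL_apply]
      linarith)
  refine ⟨G, G.2, fun H hH => ?_⟩
  have := DFunLike.congr_fun hG ⟨H, hH⟩
  simp only [ContinuousLinearMap.comp_apply, sub_apply,
    Submodule.subtypeL_apply, zero_apply, sub_eq_zero] at this
  rw [← hS, this, hℓ, fluxFunctional_apply]

end Flux

theorem theorem1p0 (n N : ℕ) (hn : 2 ≤ n) (hN : 1 ≤ N) (p μ : ℝ) (hp : 1 < p)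
    (hμ : μ ∈ Set.Icc (0 : ℝ) 1)
    (Ω : Opens (RVec n)) (hΩ : Bornology.IsBounded (Ω : Set (RVec n)))
    (c₁ c₂ : ℝ) (hc : IsStructurePair N n p μ c₁ c₂)
    (γ₀ γ₁ γ₂ : ℝ) (hγ₀ : 0 < γ₀) (hγ₁ : 0 < γ₁) (hγ₂ : 0 < γ₂)
    (a : RVec n → ℂ) (ha : IsAdmissibleCoeff Ω (sectorConst c₁ c₂) γ₀ γ₁ γ₂ a)
    (F : RVec n → CMat N n)
    (hF : MemLp F (ENNReal.ofReal p) (volume.restrict (Ω : Set (RVec n)))) :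
    ∃! u : Lp (CVec N) (ENNReal.ofReal p) (volume.restrict (Ω : Set (RVec n))),
      IsWeakSolution Ω p μ a F u := by
  have hn1 : 1 ≤ n := by omega
  have hfin : IsFiniteMeasure (volume.restrict (Ω : Set (RVec n))) :=
    isFiniteMeasure_restrict.2 hΩ.measure_lt_top.ne
  have hp1 : Fact (1 ≤ ENNReal.ofReal p) := ⟨by simpa using hp.le⟩
  have hq := Real.HolderConjugate.conjExponent hp
  have hqp := hq.symm.ennrealOfReal
  have hq1 : Fact (1 ≤ ENNReal.ofReal (Real.conjExponent p)) := ⟨by simpa using hq.symm.lt.le⟩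
  obtain ⟨hκ, hκ'⟩ := hc.ratio_bounds hn1 hN hp
  have hbd : ∀ᵐ x ∂(volume.restrict (Ω : Set (RVec n))), ‖a x‖ ≤ γ₂ :=
    ha.bounds.mono fun x hx => hx.2
  have hFq := memLp_rpow_smul hp hF
  have hAq : ∀ {G : RVec n → CMat N n},
      MemLp G (ENNReal.ofReal p) (volume.restrict (Ω : Set (RVec n))) → _ := fun hG =>
    memLp_smul_pField hp hμ ha.measurable hbd hG
  obtain ⟨G, hG, hGeq⟩ := exists_flux_eq (V := gradSpace N Ω (ENNReal.ofReal p)) hp hμ hκ hκ' hγ₀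
    ha.measurable hbd ha.sector (Submodule.isClosed_topologicalClosure _) hFq
  obtain ⟨u, hu⟩ := exists_hasSobolevZeroGradient hn1 hp hΩ hG
  refine ⟨u, ⟨G, hu, fun φ Dφ hφ => ?_⟩, fun v ⟨Dv, hv, hveq⟩ => ?_⟩
  · simp only [← matInner_smul_left]
    have hi1 := integrable_matInner (hAq hu.1.memLp_grad) hφ.1.memLp_grad
    have hi2 := integrable_matInner hFq hφ.1.memLp_grad
    have hD := toLp_mem_gradSpace hp hφ
    have hcoe := hφ.1.memLp_grad.coeFn_toLp
    have hpair : ∀ W : RVec n → CMat N n,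
        ∫ x in (Ω : Set (RVec n)), inner ℝ (W x) (hφ.1.memLp_grad.toLp Dφ x)
          = ∫ x in (Ω : Set (RVec n)), inner ℝ (W x) (Dφ x) ∧
        ∫ x in (Ω : Set (RVec n)), inner ℝ (W x) ((Complex.I • hφ.1.memLp_grad.toLp Dφ :
            Lp (CMat N n) (ENNReal.ofReal p) (volume.restrict (Ω : Set (RVec n)))) x)
          = ∫ x in (Ω : Set (RVec n)), inner ℝ (W x) (Complex.I • Dφ x) := by
      intro W
      constructor
      · refine integral_congr_ae ?_
        filter_upwards [hcoe] with x hx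
        rw [hx]
      · refine integral_congr_ae ?_
        filter_upwards [hcoe, Lp.coeFn_smul Complex.I (hφ.1.memLp_grad.toLp Dφ)] with x hx hx'
        rw [hx', Pi.smul_apply, hx]
    apply Complex.ext
    · rw [re_integral_matInner hi1, re_integral_matInner hi2, ← (hpair _).1, ← (hpair _).1]
      exact hGeq _ hD
    · rw [im_integral_matInner hi1, im_integral_matInner hi2, ← (hpair _).2, ← (hpair _).2]
      exact hGeq _ (I_smul_mem_gradSpace hD)
  · have hDv := toLp_mem_gradSpace hp hv
    -- the difference of the gradients is the gradient of an admissible test function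
    obtain ⟨w, hw⟩ := exists_hasSobolevZeroGradient hn1 hp hΩ (Submodule.sub_mem _ hDv hG)
    have e1 := hveq w _ hw
    simp only [← matInner_smul_left] at e1
    have hi1 := integrable_matInner (hAq hv.1.memLp_grad) hw.1.memLp_grad
    have hi2 := integrable_matInner hFq hw.1.memLp_grad
    have hre := congrArg Complex.re e1
    rw [re_integral_matInner hi1, re_integral_matInner hi2,
      ← hGeq _ (Submodule.sub_mem _ hDv hG), ← sub_eq_zero,
      ← integral_sub (integrable_real_inner (hAq hv.1.memLp_grad) hw.1.memLp_grad)
        (integrable_real_inner (hAq hu.1.memLp_grad) hw.1.memLp_grad)] at hre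
    have hae : ∀ᵐ x ∂(volume.restrict (Ω : Set (RVec n))),
        inner ℝ (a x • pField p μ (Dv x)) ((hv.1.memLp_grad.toLp Dv - G : Lp (CMat N n)
            (ENNReal.ofReal p) (volume.restrict (Ω : Set (RVec n)))) x)
          - inner ℝ (a x • pField p μ (G x)) ((hv.1.memLp_grad.toLp Dv - G : Lp (CMat N n)
            (ENNReal.ofReal p) (volume.restrict (Ω : Set (RVec n)))) x)
          = (a x * matInner (pField p μ (Dv x) - pField p μ (G x)) (Dv x - G x)).re := by
      filter_upwards [hv.1.memLp_grad.coeFn_toLp, Lp.coeFn_sub (hv.1.memLp_grad.toLp Dv) G]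
        with x h1 h2
      rw [h2, Pi.sub_apply, h1, ← inner_sub_left, real_inner_smul_pField_sub]
    have hge : ∀ᵐ x ∂(volume.restrict (Ω : Set (RVec n))),
        γ₀ * (matInner (pField p μ (Dv x) - pField p μ (G x)) (Dv x - G x)).re
          ≤ (a x * matInner (pField p μ (Dv x) - pField p μ (G x)) (Dv x - G x)).re :=
      ha.sector.mono fun x hx => re_mul_matInner_pField_sub_ge hp hκ hκ' hx _ _
    rw [integral_eq_zero_iff_of_nonneg_ae] at hre
    · have hDG : hv.1.memLp_grad.toLp Dv = hu.1.memLp_grad.toLp G := by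
        refine MemLp.toLp_congr _ _ ?_
        filter_upwards [hre, hae, hge] with x h1 h2 h3
        by_contra hne
        have h4 := re_matInner_pField_sub_pos (μ := μ) hp _ _ hne
        rw [h2, Pi.zero_apply] at h1
        rw [h1] at h3
        nlinarith
      obtain ⟨C, hC, H⟩ := exists_norm_toLp_sub_le (N := N) hn1 hp hΩ
      have h5 := H _ _ _ _ hv hu
      rw [hDG, sub_self, norm_zero, mul_zero, norm_le_zero_iff, sub_eq_zero, Lp.toLp_coeFn,
        Lp.toLp_coeFn] at h5
      exact h5
    · filter_upwards [hae, hge] with x h1 h2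
      rw [h1]
      exact (mul_nonneg hγ₀.le (re_matInner_pField_sub_nonneg hp _ _)).trans h2
    · exact (integrable_real_inner (hAq hv.1.memLp_grad) hw.1.memLp_grad).sub
        (integrable_real_inner (hAq hu.1.memLp_grad) hw.1.memLp_grad)
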